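/- Let $k$ be a field with $2\neq 0$, let $A$ be a commutative superalgebra over $k$, and let $V=A^{n|m}$ be the free superspace of dimension $n|m$ over $A$. Write $\tilde a,\tilde\imath\in\{0,1\}$ for the parities of the indices $a\in\{1,\dots,n,\hat 1,\dots,\hat m\}$ and $i\in\{1,\dots,r,\hat 1,\dots,\hat s\}$ (hatted indices are odd). Let $F$ be a simple multivector of degree $r|s$ on $V$, that is, the non-linear wedge product $$F=[u_1,\dots,u_r\,|\,u_{\hat 1},\dots,u_{\hat s}],\qquad F(p)=\operatorname{Ber}\bigl(\langle u_i,p^j\rangle\bigr),\qquad \langle u_i,p^j\rangle=\sum_a u_i{}^a\,p_a{}^j ,$$ of $r$ even and $s$ odd linearly independent vectors $u_i\in V$. It is an even rational function of $r$ even and $s$ odd covectors $p^j$ with coordinates $p_a{}^j$ of parity $\tilde a+\tilde\jmath$, defined where the odd-odd block of $(\langle u_i,p^j\rangle)$ is invertible, for coordinates in any commutative superalgebra over $A$. Then $F$ belongs to $\Lambda^{r|s}(V)$, i.e. $F(p\cdot g)=F(p)\operatorname{Ber} g$ for all $g\in GL(r|s)$ and $$\frac{\partial^2F}{\partial p_a{}^i\,\partial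 p_b{}^j}+(-1)^{\tilde\imath\tilde\jmath+\tilde a(\tilde\imath+\tilde\jmath)}\frac{\partial^2F}{\partial p_a{}^j\,\partial p_b{}^i}=0,$$ and $F$ satisfies in addition the Khudaverdian relations $$\frac{\partial F}{\partial p_a{}^i}\,\frac{\partial F}{\partial p_b{}^j}-(-1)^{\tilde\imath\tilde\jmath+\tilde a(\tilde\imath+\tilde\jmath)}\,\frac{\partial F}{\partial p_a{}^j}\,\frac{\partial F}{\partial p_b{}^i}-F\,\frac{\partial^2F}{\partial p_a{}^i\,\partial p_b{}^j}=0$$ for all $i,j\in\{1,\dots,r,\hat 1,\dots,\hat s\}$ and $a,b\in\{1,\dots,n,\hat 1,\dots,\hat m\}$. Here the derivatives are left derivatives and $\partial^2/\partial p_a{}^i\partial p_b{}^j=(\partial/\partial p_a{}^i)(\partial/\partial p_b{}^j)$. -/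

import Mathlib

universe u

open DirectSum

/-- A (super)commutative superalgebra over a field `k`: an associative unital `k`-algebra graded by
`ZMod 2` whose homogeneous elements satisfy `y x = (-1)^{|x||y|} x y`. -/
structure SuperCommAlg (k : Type u) [Field k] : Type (u + 1) where
  carrier : Type u
  [ring : Ring carrier]
  [algebra : Algebra k carrier]
  grading : ZMod 2 → Submodule k carrier
  [graded : GradedAlgebra grading]
  super_comm : ∀ (i j : ZMod 2) (x y : carrier), x ∈ grading i → y ∈ grading j →
    y * x = (-1) ^ (i.val * j.val) * (x * y)

namespace SuperCommAlg

variable {k : Type u} [Field k]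

instance : CoeSort (SuperCommAlg k) (Type u) := ⟨carrier⟩
instance (B : SuperCommAlg k) : Ring B := B.ring
instance (B : SuperCommAlg k) : Algebra k B := B.algebra
instance (B : SuperCommAlg k) : GradedAlgebra B.grading := B.graded

/-- The even part `B₀` is a commutative ring. -/
instance (B : SuperCommAlg k) : CommRing (B.grading 0) :=
  { SetLike.GradeZero.instRing B.grading with
    mul_comm := fun x y => Subtype.ext (by
      have h := B.super_comm 0 0 y x y.2 x.2
      simpa using h) }

/-- The even component of an element. -/
def ev (B : SuperCommAlg k) (x : B) : B.grading 0 := decompose B.grading x 0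

/-- Passing an element `x` through a symbol of parity `q`: the linear map which is
`(-1)^{q|x|} x` on homogeneous `x`. -/
def twist (B : SuperCommAlg k) (q : ZMod 2) (x : B) : B :=
  (decompose B.grading x 0 : B) + (-1) ^ q.val * (decompose B.grading x 1 : B)

/-- Even homomorphisms of commutative superalgebras. -/
structure Hom (A B : SuperCommAlg k) where
  toAlgHom : A →ₐ[k] B
  map_mem : ∀ (i : ZMod 2) (x : A), x ∈ A.grading i → toAlgHom x ∈ B.grading i

instance (A B : SuperCommAlg k) : CoeFun (Hom A B) (fun _ => A → B) := ⟨fun f => f.toAlgHom⟩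

/-- Composition of homomorphisms. -/
def Hom.comp {A B C : SuperCommAlg k} (g : Hom B C) (f : Hom A B) : Hom A C where
  toAlgHom := g.toAlgHom.comp f.toAlgHom
  map_mem i x hx := g.map_mem i _ (f.map_mem i x hx)

section basic

variable (B : SuperCommAlg k)

theorem zmod_cases (i : ZMod 2) : i = 0 ∨ i = 1 := by
  revert i
  decide

theorem ev_of_mem {x : B} (hx : x ∈ B.grading 0) : (B.ev x : B) = x :=
  decompose_of_mem_same B.grading hx

theorem decompose_add_eq (x : B) :
    (decompose B.grading x 0 : B) + (decompose B.grading x 1 : B) = x := by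
  classical
  conv_rhs => rw [← DirectSum.sum_support_decompose B.grading x]
  rw [Finset.sum_subset (Finset.subset_univ _)]
  · exact (Fin.sum_univ_two (fun i : Fin 2 => (decompose B.grading x i : B))).symm
  · intro i _ hi
    simpa using hi

theorem twist_of_mem {x : B} (q i : ZMod 2) (hx : x ∈ B.grading i) :
    B.twist q x = (-1) ^ (q.val * i.val) * x := by
  unfold twist
  rcases zmod_cases i with rfl | rfl
  · have h1 := decompose_of_mem_same B.grading (i := 0) hx
    have h2 := decompose_of_mem_ne B.grading (i := 0) (j := 1) hx (by decide)
    rw [h1, h2]; simp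
  · have h1 := decompose_of_mem_same B.grading (i := 1) hx
    have h2 := decompose_of_mem_ne B.grading (i := 1) (j := 0) hx (by decide)
    rw [h1, h2, ZMod.val_one]; simp

theorem twist_add (q : ZMod 2) (x y : B) : B.twist q (x + y) = B.twist q x + B.twist q y := by
  simp only [twist, decompose_add, DirectSum.add_apply, Submodule.coe_add, mul_add]
  abel

theorem twist_algebraMap (q : ZMod 2) (c : k) :
    B.twist q (algebraMap k B c) = algebraMap k B c := by
  rw [B.twist_of_mem q 0 (SetLike.algebraMap_mem_graded B.grading c)]
  simp

theorem twist_mul (q : ZMod 2) (x y : B) : B.twist q (x * y) = B.twist q x * B.twist q y := by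
  have key : ∀ (i j : ZMod 2) (x y : B), x ∈ B.grading i → y ∈ B.grading j →
      B.twist q (x * y) = B.twist q x * B.twist q y := by
    intro i j x y hx hy
    rw [B.twist_of_mem q i hx, B.twist_of_mem q j hy,
      B.twist_of_mem q (i + j) (SetLike.mul_mem_graded hx hy)]
    have h2 : (-1 : B) ^ (q.val * (i + j).val) = (-1) ^ (q.val * i.val) * (-1) ^ (q.val * j.val) := by
      have h : ∀ q i j : ZMod 2,
          q.val * (i + j).val % 2 = (q.val * i.val + q.val * j.val) % 2 := by decide
      rw [← pow_add, neg_one_pow_eq_pow_mod_two, neg_one_pow_eq_pow_mod_two (n := _ + _), h]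
    rw [h2]
    rcases neg_one_pow_eq_or B (q.val * i.val) with h | h <;>
    rcases neg_one_pow_eq_or B (q.val * j.val) with h' | h' <;> simp [h, h']
  rw [← B.decompose_add_eq x, ← B.decompose_add_eq y]
  simp only [mul_add, add_mul, twist_add]
  rw [key 0 0 _ _ (SetLike.coe_mem _) (SetLike.coe_mem _),
    key 0 1 _ _ (SetLike.coe_mem _) (SetLike.coe_mem _),
    key 1 0 _ _ (SetLike.coe_mem _) (SetLike.coe_mem _),
    key 1 1 _ _ (SetLike.coe_mem _) (SetLike.coe_mem _)]

theorem twist_mem (q i : ZMod 2) {x : B} (hx : x ∈ B.grading i) : B.twist q x ∈ B.grading i := by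
  rw [B.twist_of_mem q i hx]
  rcases neg_one_pow_eq_or B (q.val * i.val) with h | h <;> simp [h, hx]

theorem Hom.map_decompose {A B : SuperCommAlg k} (f : Hom A B) (x : A) (i : ZMod 2) :
    (decompose B.grading (f x) i : B) = f (decompose A.grading x i : A) := by
  conv_lhs => rw [← A.decompose_add_eq x, map_add, decompose_add]
  have h0 := f.map_mem 0 _ (SetLike.coe_mem (decompose A.grading x 0))
  have h1 := f.map_mem 1 _ (SetLike.coe_mem (decompose A.grading x 1))
  rw [DirectSum.add_apply, Submodule.coe_add]
  rcases zmod_cases i with rfl | rfl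
  · exact (congrArg₂ (· + ·) (decompose_of_mem_same B.grading h0)
      (decompose_of_mem_ne B.grading h1 (by decide))).trans (add_zero _)
  · exact (congrArg₂ (· + ·) (decompose_of_mem_ne B.grading h0 (by decide))
      (decompose_of_mem_same B.grading h1)).trans (zero_add _)

theorem Hom.map_twist {A B : SuperCommAlg k} (f : Hom A B) (q : ZMod 2) (x : A) :
    f (A.twist q x) = B.twist q (f x) := by
  simp only [twist, f.map_decompose, map_add, map_mul, map_pow, map_neg, map_one]

end basic

/-- The restriction of a homomorphism to the even parts. -/
def Hom.evenHom {A B : SuperCommAlg k} (f : Hom A B) : A.grading 0 →+* B.grading 0 where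
  toFun x := ⟨f x, f.map_mem 0 _ x.2⟩
  map_one' := Subtype.ext (map_one f.toAlgHom)
  map_mul' _ _ := Subtype.ext (map_mul f.toAlgHom _ _)
  map_zero' := Subtype.ext (map_zero f.toAlgHom)
  map_add' _ _ := Subtype.ext (map_add f.toAlgHom _ _)

/-! ### Adjoining a square-zero parameter of parity `q` -/

/-- The elements `fst + ε snd` of `B[ε]`. -/
@[ext] structure Eps (B : SuperCommAlg k) (q : ZMod 2) : Type u where
  fst : B
  snd : B

namespace Eps

variable {B : SuperCommAlg k} {q : ZMod 2}

instance : Zero (Eps B q) := ⟨⟨0, 0⟩⟩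
instance : One (Eps B q) := ⟨⟨1, 0⟩⟩
instance : Add (Eps B q) := ⟨fun x y => ⟨x.fst + y.fst, x.snd + y.snd⟩⟩
instance : Neg (Eps B q) := ⟨fun x => ⟨-x.fst, -x.snd⟩⟩
/-- `(a + ε b)(a' + ε b') = a a' + ε (b a' + (-1)^{q|a|} a b')`. -/
instance : Mul (Eps B q) :=
  ⟨fun x y => ⟨x.fst * y.fst, x.snd * y.fst + B.twist q x.fst * y.snd⟩⟩

@[simp] theorem zero_fst : (0 : Eps B q).fst = 0 := rfl
@[simp] theorem zero_snd : (0 : Eps B q).snd = 0 := rfl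
@[simp] theorem one_fst : (1 : Eps B q).fst = 1 := rfl
@[simp] theorem one_snd : (1 : Eps B q).snd = 0 := rfl
@[simp] theorem add_fst (x y : Eps B q) : (x + y).fst = x.fst + y.fst := rfl
@[simp] theorem add_snd (x y : Eps B q) : (x + y).snd = x.snd + y.snd := rfl
@[simp] theorem neg_fst (x : Eps B q) : (-x).fst = -x.fst := rfl
@[simp] theorem neg_snd (x : Eps B q) : (-x).snd = -x.snd := rfl
@[simp] theorem mul_fst (x y : Eps B q) : (x * y).fst = x.fst * y.fst := rfl
@[simp] theorem mul_snd (x y : Eps B q) :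
    (x * y).snd = x.snd * y.fst + B.twist q x.fst * y.snd := rfl

theorem twist_one' : B.twist q 1 = 1 := by
  simpa using B.twist_algebraMap q 1

theorem twist_zero' : B.twist q 0 = 0 := by
  simpa using B.twist_algebraMap q 0

instance : Ring (Eps B q) where
  add_assoc x y z := by ext <;> simp [add_assoc]
  zero_add x := by ext <;> simp
  add_zero x := by ext <;> simp
  add_comm x y := by ext <;> simp [add_comm]
  nsmul := nsmulRec
  zsmul := zsmulRec
  neg_add_cancel x := by ext <;> simp
  mul_assoc x y z := by
    ext <;> simp [mul_assoc, add_mul, mul_add, B.twist_mul, add_assoc]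
  one_mul x := by ext <;> simp [twist_one']
  mul_one x := by ext <;> simp
  zero_mul x := by ext <;> simp [twist_zero']
  mul_zero x := by ext <;> simp
  left_distrib x y z := by
    ext <;> simp [mul_add]
    abel
  right_distrib x y z := by
    ext <;> simp [add_mul, B.twist_add]
    abel

instance : Algebra k (Eps B q) where
  algebraMap :=
    { toFun := fun c => ⟨algebraMap k B c, 0⟩
      map_one' := by ext <;> simp
      map_mul' := fun x y => by ext <;> simp
      map_zero' := by ext <;> simp
      map_add' := fun x y => by ext <;> simp }
  smul c x := ⟨c • x.fst, c • x.snd⟩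
  commutes' c x := by
    ext
    · exact Algebra.commutes c x.fst
    · simp only [RingHom.coe_mk, MonoidHom.coe_mk, OneHom.coe_mk, mul_snd, B.twist_algebraMap,
        zero_mul, zero_add, mul_zero, add_zero]
      exact Algebra.commutes c x.snd
  smul_def' c x := by
    ext
    · exact Algebra.smul_def c x.fst
    · simp only [RingHom.coe_mk, MonoidHom.coe_mk, OneHom.coe_mk, mul_snd, B.twist_algebraMap,
        zero_mul, zero_add]
      exact Algebra.smul_def c x.snd

@[simp] theorem smul_fst (c : k) (x : Eps B q) : (c • x).fst = c • x.fst := rfl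
@[simp] theorem smul_snd (c : k) (x : Eps B q) : (c • x).snd = c • x.snd := rfl

/-- `a + ε b` has parity `i` when `a` has parity `i` and `b` has parity `i + q`. -/
def grade (B : SuperCommAlg k) (q i : ZMod 2) : Submodule k (Eps B q) where
  carrier := {x | x.fst ∈ B.grading i ∧ x.snd ∈ B.grading (i + q)}
  zero_mem' := ⟨Submodule.zero_mem _, Submodule.zero_mem _⟩
  add_mem' hx hy := ⟨Submodule.add_mem _ hx.1 hy.1, Submodule.add_mem _ hx.2 hy.2⟩
  smul_mem' c _ hx := ⟨Submodule.smul_mem _ c hx.1, Submodule.smul_mem _ c hx.2⟩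

/-- The homogeneous component of parity `i`. -/
def component (i : ZMod 2) (x : Eps B q) : grade B q i :=
  ⟨⟨decompose B.grading x.fst i, decompose B.grading x.snd (i + q)⟩,
    SetLike.coe_mem _, SetLike.coe_mem _⟩

theorem component_add (i : ZMod 2) (x y : Eps B q) :
    component i (x + y) = component i x + component i y := by
  apply Subtype.ext
  ext <;> simp [component, decompose_add]

theorem component_same (i : ZMod 2) (x : grade B q i) : component i (x : Eps B q) = x := by
  apply Subtype.ext
  ext
  · exact decompose_of_mem_same B.grading x.2.1
  · exact decompose_of_mem_same B.grading x.2.2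

theorem component_ne {i j : ZMod 2} (h : i ≠ j) (x : grade B q i) :
    component j (x : Eps B q) = 0 := by
  apply Subtype.ext
  ext
  · exact decompose_of_mem_ne B.grading x.2.1 h
  · exact decompose_of_mem_ne B.grading x.2.2 (fun h' => h (add_right_cancel h'))

theorem component_sum (x : Eps B q) :
    ((component 0 x : Eps B q) + (component 1 x : Eps B q)) = x := by
  ext
  · exact B.decompose_add_eq x.fst
  · change (decompose B.grading x.snd (0 + q) : B) + (decompose B.grading x.snd (1 + q) : B) = x.snd
    have h := B.decompose_add_eq x.snd
    fin_cases q
    · exact h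
    · exact (add_comm _ _).trans h

instance gradedAlgebra : GradedAlgebra (grade B q) where
  one_mem := ⟨SetLike.one_mem_graded B.grading, Submodule.zero_mem _⟩
  mul_mem := by
    intro i j x y hx hy
    refine ⟨SetLike.mul_mem_graded hx.1 hy.1, Submodule.add_mem _ ?_ ?_⟩
    · have := SetLike.mul_mem_graded hx.2 hy.1
      rwa [add_right_comm] at this
    · have := SetLike.mul_mem_graded (B.twist_mem q i hx.1) hy.2
      rwa [← add_assoc] at this
  decompose' x := DirectSum.of (fun i => grade B q i) 0 (component 0 x) +
    DirectSum.of (fun i => grade B q i) 1 (component 1 x)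
  left_inv x := by
    rw [map_add, DirectSum.coeAddMonoidHom_of, DirectSum.coeAddMonoidHom_of]
    exact component_sum x
  right_inv x := by
    induction x using DirectSum.induction_on with
    | zero =>
      have h : ∀ i, component i (0 : Eps B q) = 0 := fun i => by
        apply Subtype.ext; ext <;> simp [component]
      simp [h]
    | of i x =>
      rw [DirectSum.coeAddMonoidHom_of]
      beta_reduce
      rcases zmod_cases i with rfl | rfl
      · rw [component_same (0 : ZMod 2) x, component_ne (i := 0) (j := 1) (by decide) x, map_zero,
          add_zero]
      · rw [component_same (1 : ZMod 2) x, component_ne (i := 1) (j := 0) (by decide) x, map_zero,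
          zero_add]
    | add x y hx hy =>
      beta_reduce at hx hy ⊢
      rw [map_add, component_add, component_add, map_add, map_add, add_add_add_comm, hx, hy]

end Eps

/-- The commutative superalgebra `B[ε] = B ⊕ ε B`, where `ε` has parity `q` and `ε² = 0`. -/
def eps (B : SuperCommAlg k) (q : ZMod 2) : SuperCommAlg k where
  carrier := Eps B q
  grading := Eps.grade B q
  super_comm i j x y hx hy := by
    have hs : ∀ (e : ℕ) (z : Eps B q), (-1) ^ e * z = ⟨(-1) ^ e * z.fst, (-1) ^ e * z.snd⟩ := by
      intro e z
      rcases Nat.even_or_odd e with h | h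
      · simp [h.neg_one_pow]
      · ext <;> simp [h.neg_one_pow]
    rw [hs]
    ext
    · exact B.super_comm i j _ _ hx.1 hy.1
    · change y.snd * x.fst + B.twist q y.fst * x.snd =
        (-1) ^ (i.val * j.val) * (x.snd * y.fst + B.twist q x.fst * y.snd)
      rw [B.twist_of_mem q i hx.1, B.twist_of_mem q j hy.1,
        B.super_comm i (j + q) _ _ hx.1 hy.2, mul_assoc _ y.fst,
        B.super_comm (i + q) j _ _ hx.2 hy.1]
      have key : ∀ i j q : ZMod 2, (i.val * (j + q).val) % 2 = (i.val * j.val + q.val * i.val) % 2 ∧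
          (q.val * j.val + (i + q).val * j.val) % 2 = (i.val * j.val) % 2 := by decide
      obtain ⟨k1, k2⟩ := key i j q
      rw [mul_add, ← mul_assoc ((-1 : B) ^ (q.val * j.val)), ← pow_add, mul_assoc _ x.fst,
        ← mul_assoc ((-1 : B) ^ (i.val * j.val)) _ (x.fst * y.snd), ← pow_add,
        neg_one_pow_eq_pow_mod_two (n := i.val * (j + q).val), k1, ← neg_one_pow_eq_pow_mod_two,
        neg_one_pow_eq_pow_mod_two (n := q.val * j.val + (i + q).val * j.val), k2,
        ← neg_one_pow_eq_pow_mod_two, add_comm]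

/-- The inclusion `B → B[ε]`. -/
def epsIncl (B : SuperCommAlg k) (q : ZMod 2) : Hom B (B.eps q) where
  toAlgHom :=
    { toFun := fun b => (⟨b, 0⟩ : Eps B q)
      map_one' := rfl
      map_mul' := fun x y => by
        change (⟨x * y, 0⟩ : Eps B q) = ⟨x, 0⟩ * ⟨y, 0⟩
        ext <;> simp
      map_zero' := rfl
      map_add' := fun x y => by
        change (⟨x + y, 0⟩ : Eps B q) = ⟨x, 0⟩ + ⟨y, 0⟩
        ext <;> simp
      commutes' := fun _ => rfl }
  map_mem _ _ hx := ⟨hx, Submodule.zero_mem _⟩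

/-- The reduction `B[ε] → B`, `ε ↦ 0`. -/
def epsProj (B : SuperCommAlg k) (q : ZMod 2) : Hom (B.eps q) B where
  toAlgHom :=
    { toFun := fun x => Eps.fst x
      map_one' := rfl
      map_mul' := fun _ _ => rfl
      map_zero' := rfl
      map_add' := fun _ _ => rfl
      commutes' := fun _ => rfl }
  map_mem _ _ hx := hx.1

/-- The extension `B[ε] → C[ε]` of a homomorphism `B → C`. -/
def Hom.eps {B C : SuperCommAlg k} (f : Hom B C) (q : ZMod 2) : Hom (B.eps q) (C.eps q) where
  toAlgHom :=
    { toFun := fun x => (⟨f (Eps.fst x), f (Eps.snd x)⟩ : Eps C q)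
      map_one' := by
        change (⟨f 1, f 0⟩ : Eps C q) = 1
        ext <;> simp
      map_mul' := fun x y => by
        change (⟨f (Eps.fst x * Eps.fst y), f (Eps.snd x * Eps.fst y + B.twist q (Eps.fst x) * Eps.snd y)⟩ : Eps C q) =
          ⟨f (Eps.fst x), f (Eps.snd x)⟩ * ⟨f (Eps.fst y), f (Eps.snd y)⟩
        ext <;> simp [f.map_twist]
      map_zero' := by
        change (⟨f 0, f 0⟩ : Eps C q) = 0
        ext <;> simp
      map_add' := fun x y => by
        change (⟨f (Eps.fst x + Eps.fst y), f (Eps.snd x + Eps.snd y)⟩ : Eps C q) =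
          ⟨f (Eps.fst x), f (Eps.snd x)⟩ + ⟨f (Eps.fst y), f (Eps.snd y)⟩
        ext <;> simp
      commutes' := fun c => by
        change (⟨f (algebraMap k B c), f 0⟩ : Eps C q) = ⟨algebraMap k C c, 0⟩
        ext <;> simp }
  map_mem _ _ hx := ⟨f.map_mem _ _ hx.1, f.map_mem _ _ hx.2⟩

theorem isUnit_of_isUnit_fst (B : SuperCommAlg k) (q : ZMod 2) (x : (B.eps q).grading 0)
    (h : IsUnit ((B.epsProj q).evenHom x)) : IsUnit x := by
  obtain ⟨y, hy⟩ := h.exists_right_inv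
  let z : (B.eps q).grading 0 := (B.epsIncl q).evenHom y
  have h1 : (B.epsProj q).evenHom (x * z) = 1 := by
    rw [map_mul]; exact hy
  have hn : (x * z - 1) * (x * z - 1) = 0 := by
    have h0 : (B.epsProj q).evenHom (x * z - 1) = 0 := by rw [map_sub, h1, map_one, sub_self]
    have h0' : Eps.fst (((x * z - 1 : (B.eps q).grading 0) : B.eps q)) = 0 :=
      congrArg Subtype.val h0
    apply Subtype.ext
    generalize ((x * z - 1 : (B.eps q).grading 0)) = w at h0'
    change ((w : B.eps q) * (w : B.eps q)) = 0
    refine Eps.ext (B := B) (q := q) ?_ ?_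
    · change Eps.fst (w : B.eps q) * Eps.fst (w : B.eps q) = 0
      rw [h0', mul_zero]
    · change Eps.snd (w : B.eps q) * Eps.fst (w : B.eps q) +
        B.twist q (Eps.fst (w : B.eps q)) * Eps.snd (w : B.eps q) = 0
      rw [h0', mul_zero, Eps.twist_zero', zero_mul, add_zero]
  refine isUnit_of_mul_isUnit_left (y := z) (IsUnit.of_mul_eq_one (2 - x * z) ?_)
  linear_combination -hn

/-! ### Even supermatrices and the Berezinian -/

/-- The parity of an index: the indices of the first group are even, those of the second odd. -/
def par {α β : Type} : α ⊕ β → ℕ := Sum.elim (fun _ => 0) (fun _ => 1)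

/-- Even supermatrices: the entry in position `(a, i)` has parity `|a| + |i|`. -/
def IsEvenMatrix (B : SuperCommAlg k) {α β γ δ : Type} (P : Matrix (α ⊕ β) (γ ⊕ δ) B) : Prop :=
  ∀ a i, P a i ∈ B.grading ((par a + par i : ℕ) : ZMod 2)

/-- The odd-odd block of an even supermatrix, as a matrix over the commutative ring `B₀`. -/
def oddBlock (B : SuperCommAlg k) {r s : ℕ} (g : Matrix (Fin r ⊕ Fin s) (Fin r ⊕ Fin s) B) :
    Matrix (Fin s) (Fin s) (B.grading 0) :=
  g.toBlocks₂₂.map B.ev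

/-- `g₀₀ - g₀₁ g₁₁⁻¹ g₁₀`, as a matrix over the commutative ring `B₀`. -/
noncomputable def schur (B : SuperCommAlg k) {r s : ℕ}
    (g : Matrix (Fin r ⊕ Fin s) (Fin r ⊕ Fin s) B) : Matrix (Fin r) (Fin r) (B.grading 0) :=
  (g.toBlocks₁₁ - g.toBlocks₁₂ * (B.oddBlock g)⁻¹.map Subtype.val * g.toBlocks₂₁).map B.ev

/-- The Berezinian `det (g₀₀ - g₀₁ g₁₁⁻¹ g₁₀) / det g₁₁` of an even supermatrix `g` for which
`det g₁₁` is invertible. -/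
noncomputable def ber (B : SuperCommAlg k) {r s : ℕ}
    (g : Matrix (Fin r ⊕ Fin s) (Fin r ⊕ Fin s) B) : B.grading 0 :=
  (B.schur g).det * Ring.inverse (B.oddBlock g).det

section naturality

variable {B C : SuperCommAlg k} (f : Hom B C)

theorem Hom.map_ev (x : B) : f.evenHom (B.ev x) = C.ev (f x) :=
  Subtype.ext (f.map_decompose x 0).symm

theorem Hom.map_oddBlock {r s : ℕ} (g : Matrix (Fin r ⊕ Fin s) (Fin r ⊕ Fin s) B) :
    C.oddBlock (g.map f) = (B.oddBlock g).map f.evenHom := by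
  exact Matrix.ext fun i j => (f.map_ev _).symm

theorem Hom.map_det_oddBlock {r s : ℕ} (g : Matrix (Fin r ⊕ Fin s) (Fin r ⊕ Fin s) B) :
    (C.oddBlock (g.map f)).det = f.evenHom (B.oddBlock g).det := by
  rw [f.map_oddBlock, RingHom.map_det]
  rfl

theorem Hom.map_schur {r s : ℕ} (g : Matrix (Fin r ⊕ Fin s) (Fin r ⊕ Fin s) B)
    (h : IsUnit (B.oddBlock g).det) :
    C.schur (g.map f) = (B.schur g).map f.evenHom := by
  have hinv : (C.oddBlock (g.map f))⁻¹ = ((B.oddBlock g)⁻¹).map f.evenHom := by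
    rw [f.map_oddBlock]
    apply Matrix.inv_eq_right_inv
    rw [← Matrix.map_mul, Matrix.mul_nonsing_inv _ h]
    exact Matrix.map_one _ (map_zero _) (map_one _)
  unfold schur
  rw [hinv]
  ext i j : 2
  simp only [Matrix.map_apply]
  rw [f.map_ev]
  congr 1
  simp only [Matrix.sub_apply, Matrix.mul_apply, map_sub, map_sum, map_mul]
  rfl

theorem Hom.map_ber {r s : ℕ} (g : Matrix (Fin r ⊕ Fin s) (Fin r ⊕ Fin s) B)
    (h : IsUnit (B.oddBlock g).det) : C.ber (g.map f) = f.evenHom (B.ber g) := by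
  unfold ber
  have hd : Ring.inverse (f.evenHom (B.oddBlock g).det) =
      f.evenHom (Ring.inverse (B.oddBlock g).det) := by
    refine (h.map f.evenHom).mul_left_cancel ?_
    rw [Ring.mul_inverse_cancel _ (h.map f.evenHom), ← map_mul, Ring.mul_inverse_cancel _ h,
      map_one]
  rw [f.map_schur g h, f.map_det_oddBlock, hd, map_mul, RingHom.map_det]
  rfl

end naturality

end SuperCommAlg

open SuperCommAlg

/-- Rational functions, over the commutative superalgebra `A`, of an even `n|m × r|s` matrix `P` of
indeterminates, in the language of points. The function is defined at those `B`-valued points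
`P`, for `B` any commutative superalgebra over `A` (with structure homomorphism `φ`), at which the
even polynomial `den` is invertible; its value there is `val φ P`. Both are compatible with
homomorphisms `B → C`. -/
structure SuperFunction {k : Type u} [Field k] (A : SuperCommAlg k) (n m r s : ℕ) where
  den : ∀ {B : SuperCommAlg k}, Hom A B → Matrix (Fin n ⊕ Fin m) (Fin r ⊕ Fin s) B → B.grading 0
  val : ∀ {B : SuperCommAlg k}, Hom A B → Matrix (Fin n ⊕ Fin m) (Fin r ⊕ Fin s) B → B
  den_map : ∀ {B C : SuperCommAlg k} (f : Hom B C) (φ : Hom A B)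
    (P : Matrix (Fin n ⊕ Fin m) (Fin r ⊕ Fin s) B), B.IsEvenMatrix P →
    den (f.comp φ) (P.map f) = f.evenHom (den φ P)
  val_map : ∀ {B C : SuperCommAlg k} (f : Hom B C) (φ : Hom A B)
    (P : Matrix (Fin n ⊕ Fin m) (Fin r ⊕ Fin s) B), B.IsEvenMatrix P → IsUnit (den φ P) →
    val (f.comp φ) (P.map f) = f (val φ P)

namespace SuperFunction

variable {k : Type u} [Field k] {A : SuperCommAlg k} {n m r s : ℕ}

/-- `P` is a `B`-valued point of the domain of `F`. -/
def Dom (F : SuperFunction A n m r s) {B : SuperCommAlg k} (φ : Hom A B)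
    (P : Matrix (Fin n ⊕ Fin m) (Fin r ⊕ Fin s) B) : Prop :=
  B.IsEvenMatrix P ∧ IsUnit (F.den φ P)

/-- The point `P + ε E` over `B[ε]`, where `E` is the matrix unit in position `(a, i)` and `ε` has
the parity of that position. -/
def shift {B : SuperCommAlg k} (P : Matrix (Fin n ⊕ Fin m) (Fin r ⊕ Fin s) B)
    (a : Fin n ⊕ Fin m) (i : Fin r ⊕ Fin s) :
    Matrix (Fin n ⊕ Fin m) (Fin r ⊕ Fin s) (B.eps ((par a + par i : ℕ) : ZMod 2)) :=
  fun b j => (⟨P b j, if b = a ∧ j = i then 1 else 0⟩ : Eps B ((par a + par i : ℕ) : ZMod 2))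

theorem shift_even {B : SuperCommAlg k} {P : Matrix (Fin n ⊕ Fin m) (Fin r ⊕ Fin s) B}
    (hP : B.IsEvenMatrix P) (a : Fin n ⊕ Fin m) (i : Fin r ⊕ Fin s) :
    (B.eps ((par a + par i : ℕ) : ZMod 2)).IsEvenMatrix (shift P a i) := by
  intro b j
  refine ⟨hP b j, ?_⟩
  change (if b = a ∧ j = i then (1 : B) else 0) ∈ _
  split_ifs with h
  · obtain ⟨rfl, rfl⟩ := h
    rw [CharTwo.add_self_eq_zero]
    exact SetLike.one_mem_graded B.grading
  · exact Submodule.zero_mem _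

theorem isUnit_den_shift (F : SuperFunction A n m r s) {B : SuperCommAlg k} (φ : Hom A B)
    {P : Matrix (Fin n ⊕ Fin m) (Fin r ⊕ Fin s) B} (hP : B.IsEvenMatrix P)
    (h : IsUnit (F.den φ P)) (a : Fin n ⊕ Fin m) (i : Fin r ⊕ Fin s) :
    IsUnit (F.den ((B.epsIncl _).comp φ) (shift P a i)) := by
  apply isUnit_of_isUnit_fst
  rw [← F.den_map _ _ _ (shift_even hP a i)]
  exact h

/-- The left partial derivative `∂F/∂p_a^i`: it is characterised by
`F(P + ε E) = F(P) + ε (∂F/∂p_a^i)(P)`, where `E` is the matrix unit in position `(a, i)` and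
`ε` is a square-zero parameter of the parity of `p_a^i`. -/
def pderiv (a : Fin n ⊕ Fin m) (i : Fin r ⊕ Fin s) (F : SuperFunction A n m r s) :
    SuperFunction A n m r s where
  den := F.den
  val {B} φ P := Eps.snd (F.val ((B.epsIncl ((par a + par i : ℕ) : ZMod 2)).comp φ) (shift P a i))
  den_map := F.den_map
  val_map {B C} f φ P hP h := by
    have key := F.val_map (f.eps ((par a + par i : ℕ) : ZMod 2)) ((B.epsIncl _).comp φ)
      (shift P a i) (shift_even hP a i) (F.isUnit_den_shift φ hP h a i)
    have h1 : (f.eps ((par a + par i : ℕ) : ZMod 2)).comp ((B.epsIncl _).comp φ) =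
        (C.epsIncl _).comp (f.comp φ) := by
      have : ∀ x, (f.eps ((par a + par i : ℕ) : ZMod 2)).comp ((B.epsIncl _).comp φ) x =
          (C.epsIncl _).comp (f.comp φ) x := by
        intro x
        refine Eps.ext rfl ?_
        exact map_zero f.toAlgHom
      have h2 := AlgHom.ext this
      revert h2
      generalize (f.eps ((par a + par i : ℕ) : ZMod 2)).comp ((B.epsIncl _).comp φ) = u
      generalize (C.epsIncl ((par a + par i : ℕ) : ZMod 2)).comp (f.comp φ) = v
      cases u; cases v
      rintro rfl
      rfl
    have h2 : (shift P a i).map (f.eps ((par a + par i : ℕ) : ZMod 2)) = shift (P.map f) a i := by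
      ext b j : 2
      refine Eps.ext rfl ?_
      change f (if b = a ∧ j = i then (1 : B) else 0) = if b = a ∧ j = i then (1 : C) else 0
      split_ifs
      · exact map_one f.toAlgHom
      · exact map_zero f.toAlgHom
    rw [h1, h2] at key
    exact congrArg Eps.snd key

/-- The sign `(-1)^{|i||j| + |a|(|i| + |j|)}`. -/
def sign (a : Fin n ⊕ Fin m) (i j : Fin r ⊕ Fin s) : ℤ :=
  (-1) ^ (par i * par j + par a * (par i + par j))

/-- `F` is a multivector of degree `r|s` on the superspace `V = A^{n|m}`, that is, an element of
`Λ^{r|s}(V)`: a function `F` of `r` even and `s` odd covectors (the columns of the matrix `P`)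
with the covariance `F(P g) = F(P) Ber g` for `g ∈ GL(r|s)`, which satisfies the fundamental
equations. -/
structure IsMultivector (F : SuperFunction A n m r s) : Prop where
  covariance : ∀ {B : SuperCommAlg k} (φ : Hom A B)
    (P : Matrix (Fin n ⊕ Fin m) (Fin r ⊕ Fin s) B)
    (g : Matrix (Fin r ⊕ Fin s) (Fin r ⊕ Fin s) B),
    F.Dom φ P → B.IsEvenMatrix g → IsUnit g →
    F.Dom φ (P * g) ∧ F.val φ (P * g) = F.val φ P * (B.ber g : B)
  fundamental : ∀ (a b : Fin n ⊕ Fin m) (i j : Fin r ⊕ Fin s) {B : SuperCommAlg k} (φ : Hom A B)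
    (P : Matrix (Fin n ⊕ Fin m) (Fin r ⊕ Fin s) B), F.Dom φ P →
    (pderiv a i (pderiv b j F)).val φ P
      + (sign a i j : B) * (pderiv a j (pderiv b i F)).val φ P = 0

/-- The Khudaverdian relations. -/
def SatisfiesKhudaverdianRelations (F : SuperFunction A n m r s) : Prop :=
  ∀ (a b : Fin n ⊕ Fin m) (i j : Fin r ⊕ Fin s) {B : SuperCommAlg k} (φ : Hom A B)
    (P : Matrix (Fin n ⊕ Fin m) (Fin r ⊕ Fin s) B), F.Dom φ P →
    (pderiv a i F).val φ P * (pderiv b j F).val φ P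
      - (sign a i j : B) * ((pderiv a j F).val φ P * (pderiv b i F).val φ P)
      - F.val φ P * (pderiv a i (pderiv b j F)).val φ P = 0

/-- The non-linear wedge product `[u₁, …, u_r | u_{r+1}, …, u_{r+s}]` of `r` even and `s` odd
vectors of `V = A^{n|m}`, given by the rows of `U`: the function
`P ↦ Ber(⟨u_i, p^j⟩) = Ber(U P)`, defined where the odd-odd block of `U P` is invertible. -/
noncomputable def nonlinearWedge (U : Matrix (Fin r ⊕ Fin s) (Fin n ⊕ Fin m) A) :
    SuperFunction A n m r s where
  den {B} φ P := (B.oddBlock (U.map φ * P)).det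
  val {B} φ P := (B.ber (U.map φ * P) : B)
  den_map {B C} f φ P _ := by
    have h : U.map (f.comp φ) * P.map f = (U.map φ * P).map f := by
      ext i j : 2
      simp only [Matrix.mul_apply, Matrix.map_apply, map_sum, map_mul]
      rfl
    rw [h, f.map_det_oddBlock]
  val_map {B C} f φ P _ hu := by
    have h : U.map (f.comp φ) * P.map f = (U.map φ * P).map f := by
      ext i j : 2
      simp only [Matrix.mul_apply, Matrix.map_apply, map_sum, map_mul]
      rfl
    rw [h, f.map_ber _ hu]
    rfl

/-- `F` is a simple multivector: it is the non-linear wedge product of some linearly independent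
`r` even and `s` odd vectors of `V = A^{n|m}` (same domain, same values there). -/
def IsSimple (F : SuperFunction A n m r s) : Prop :=
  ∃ U : Matrix (Fin r ⊕ Fin s) (Fin n ⊕ Fin m) A, A.IsEvenMatrix U ∧
    LinearIndependent A (fun i => U i) ∧
    ∀ {B : SuperCommAlg k} (φ : Hom A B) (P : Matrix (Fin n ⊕ Fin m) (Fin r ⊕ Fin s) B),
      (F.Dom φ P ↔ (nonlinearWedge U).Dom φ P) ∧
      (F.Dom φ P → F.val φ P = (nonlinearWedge U).val φ P)

end SuperFunction

/-! With `W = U P`, the function is `F(P) = Ber W`, and moving `p_a^i` moves column `i` of `W` along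
the column `u_a` of `U`. Both systems of equations are therefore statements about `Ber` and the
derivatives of its columns.

Suppose that `W` is invertible and put `θ_{ai} = (W⁻¹ u_a)_i`. Multiplicativity of `Ber`
(`rightBer`) and `W + xε = W (1 + W⁻¹x ε)` give `∂F/∂p_a^i = ± F θ_{ai}` (`berDeriv_eq`). Repeating
this over `B[ε]` gives `∂²F/∂p_a^i∂p_b^j = ± F (θ_{ai} θ_{bj} - σ θ_{aj} θ_{bi})`, where `σ` is the
sign in the equations (`berDeriv₂_eq`). The fundamental equations express the antisymmetry of the
bracket under the exchange of `i` and `j`. In the Khudaverdian relations the products of first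
derivatives reproduce the same bracket times `F²`.

On the domain of `F` only the odd-odd block `D` of `W` is invertible. So `W` is joined to the
invertible matrix `Z = diag(1, D)` by the pencil `Z + z (W - Z)`, whose odd-odd block is `D` for all
`z`. The pencil is invertible over `B[[z]]`, so the equations hold there. They already make sense
over the subring `B[z]`, hence hold in it, and `z = 1` gives them at `W`
(`IsEvenMatrix.exists_deformation`).

Multiplicativity of `Ber`, which also gives the covariance, rests on `det (1 + bc) det (1 + cb) = 1`
for odd matrices (`det_one_add_oddMul_mul_det`). -/

namespace SuperCommAlg

variable {k : Type u} [Field k]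

/-! ### Even and odd elements. -/

section parity

variable (B : SuperCommAlg k)

/-- The inclusion of the even part, as a ring homomorphism. -/
def evenVal : B.grading 0 →+* B where
  toFun x := x
  map_one' := rfl
  map_mul' _ _ := rfl
  map_zero' := rfl
  map_add' _ _ := rfl

theorem evenVal_injective : Function.Injective B.evenVal := Subtype.val_injective

theorem evenVal_ev {x : B} (hx : x ∈ B.grading 0) : B.evenVal (B.ev x) = x := B.ev_of_mem hx

@[simp] theorem ev_evenVal (x : B.grading 0) : B.ev (B.evenVal x) = x :=
  Subtype.ext (B.ev_of_mem x.2)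

theorem ev_add (x y : B) : B.ev (x + y) = B.ev x + B.ev y := by
  simp [ev, decompose_add]

theorem even_mul_comm {x : B} (hx : x ∈ B.grading 0) (y : B) : x * y = y * x := by
  rw [← B.decompose_add_eq y, mul_add, add_mul,
    B.super_comm 0 0 _ _ hx (SetLike.coe_mem _), B.super_comm 0 1 _ _ hx (SetLike.coe_mem _)]
  simp

theorem odd_mul_odd {x y : B} (hx : x ∈ B.grading 1) (hy : y ∈ B.grading 1) :
    y * x = -(x * y) := by
  have h := B.super_comm 1 1 x y hx hy
  rwa [ZMod.val_one, mul_one, pow_one, neg_one_mul] at h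

theorem odd_mul_self (h2 : (2 : k) ≠ 0) {x : B} (hx : x ∈ B.grading 1) : x * x = 0 := by
  have h : (2 : k) • (x * x) = 0 := by
    rw [two_smul]
    nth_rewrite 1 [B.odd_mul_odd hx hx]
    exact neg_add_cancel _
  exact (smul_eq_zero.mp h).resolve_left h2

theorem odd_mul_odd_mem {x y : B} (hx : x ∈ B.grading 1) (hy : y ∈ B.grading 1) :
    x * y ∈ B.grading 0 :=
  SetLike.mul_mem_graded (A := B.grading) hx hy

end parity

/-! ### Matrices with homogeneous entries and the odd Sylvester identity. -/

/-- All entries of the matrix have parity `q`. -/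
def EntriesIn (B : SuperCommAlg k) (q : ZMod 2) {m n : Type*} (M : Matrix m n B) : Prop :=
  ∀ i j, M i j ∈ B.grading q

namespace EntriesIn

variable {B : SuperCommAlg k} {m n l : Type*} {q p : ZMod 2}

theorem mul [Fintype n] {M : Matrix m n B} {N : Matrix n l B} (hM : B.EntriesIn p M)
    (hN : B.EntriesIn q N) : B.EntriesIn (p + q) (M * N) := fun i j => by
  rw [Matrix.mul_apply]
  exact Submodule.sum_mem _ fun t _ => SetLike.mul_mem_graded (hM i t) (hN t j)

theorem add {M N : Matrix m n B} (hM : B.EntriesIn q M) (hN : B.EntriesIn q N) :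
    B.EntriesIn q (M + N) := fun i j => Submodule.add_mem _ (hM i j) (hN i j)

theorem neg {M : Matrix m n B} (hM : B.EntriesIn q M) :
    B.EntriesIn q (-M) := fun i j => Submodule.neg_mem _ (hM i j)

theorem map_evenVal (M : Matrix m n (B.grading 0)) : B.EntriesIn 0 (M.map B.evenVal) :=
  fun i j => (M i j).2

theorem odd_mul_odd [Fintype n] {M : Matrix m n B} {N : Matrix n l B} (hM : B.EntriesIn 1 M)
    (hN : B.EntriesIn 1 N) : B.EntriesIn 0 (M * N) := hM.mul hN

theorem odd_mul_even [Fintype n] {M : Matrix m n B} (hM : B.EntriesIn 1 M)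
    (N : Matrix n l (B.grading 0)) : B.EntriesIn 1 (M * N.map B.evenVal) :=
  hM.mul (map_evenVal N)

theorem even_mul_odd [Fintype n] (M : Matrix m n (B.grading 0)) {N : Matrix n l B}
    (hN : B.EntriesIn 1 N) : B.EntriesIn 1 (M.map B.evenVal * N) := (map_evenVal M).mul hN

theorem map_evenVal_map_ev {M : Matrix m n B} (hM : B.EntriesIn 0 M) :
    (M.map B.ev).map B.evenVal = M := Matrix.ext fun i j => B.evenVal_ev (hM i j)

end EntriesIn

section matrices

variable (B : SuperCommAlg k) {m n l : Type*}

theorem map_evenVal_injective :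
    Function.Injective fun M : Matrix m n (B.grading 0) => M.map B.evenVal :=
  Matrix.map_injective B.evenVal_injective

theorem map_ev_map_evenVal (M : Matrix m n (B.grading 0)) : (M.map B.evenVal).map B.ev = M :=
  Matrix.ext fun _ _ => B.ev_evenVal _

theorem map_evenVal_mul [Fintype n] (M : Matrix m n (B.grading 0)) (N : Matrix n l (B.grading 0)) :
    (M * N).map B.evenVal = M.map B.evenVal * N.map B.evenVal := Matrix.map_mul

theorem map_evenVal_add (M N : Matrix m n (B.grading 0)) :
    (M + N).map B.evenVal = M.map B.evenVal + N.map B.evenVal :=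
  Matrix.map_add _ (map_add _) _ _

theorem map_evenVal_sub (M N : Matrix m n (B.grading 0)) :
    (M - N).map B.evenVal = M.map B.evenVal - N.map B.evenVal :=
  Matrix.map_sub _ (map_sub _) _ _

theorem map_evenVal_one [DecidableEq n] :
    (1 : Matrix n n (B.grading 0)).map B.evenVal = 1 :=
  Matrix.map_one _ (map_zero _) (map_one _)

theorem inv_map_mul_map [Fintype n] [DecidableEq n] {M : Matrix n n (B.grading 0)}
    (h : IsUnit M.det) : M⁻¹.map B.evenVal * M.map B.evenVal = 1 := by
  rw [← map_evenVal_mul, Matrix.nonsing_inv_mul _ h, map_evenVal_one]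

theorem map_mul_inv_map [Fintype n] [DecidableEq n] {M : Matrix n n (B.grading 0)}
    (h : IsUnit M.det) : M.map B.evenVal * M⁻¹.map B.evenVal = 1 := by
  rw [← map_evenVal_mul, Matrix.mul_nonsing_inv _ h, map_evenVal_one]

/-- The product of two odd matrices, as a matrix over the even part. -/
def oddMul [Fintype n] (b : Matrix m n B) (c : Matrix n l B) : Matrix m l (B.grading 0) :=
  (b * c).map B.ev

variable {B}

theorem map_oddMul [Fintype n] {b : Matrix m n B} {c : Matrix n l B} (hb : B.EntriesIn 1 b)
    (hc : B.EntriesIn 1 c) : (B.oddMul b c).map B.evenVal = b * c :=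
  (hb.odd_mul_odd hc).map_evenVal_map_ev

theorem det_one_add_single_mul [Fintype m] [Fintype n] [DecidableEq m] [DecidableEq n]
    (i : m) (j : n) (x : B) (c : Matrix n m B) :
    (1 + B.oddMul (Matrix.single i j x) c).det = 1 + B.ev (x * c j i) := by
  have h : B.oddMul (Matrix.single i j x) c = Matrix.replicateCol Unit (Pi.single i (1 : B.grading 0)) *
      Matrix.replicateRow Unit (fun l => B.ev (x * c j l)) := by
    ext a l : 2
    rw [oddMul, Matrix.map_apply, Matrix.mul_apply, Matrix.mul_apply]
    simp only [Matrix.single_apply, ite_mul, zero_mul, Finset.univ_unique, Finset.sum_singleton,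
      Matrix.replicateCol_apply, Matrix.replicateRow_apply, Pi.single_apply]
    by_cases h : i = a
    · subst h
      simp
    · simp [h, Ne.symm h, ev]
  rw [h, Matrix.det_one_add_replicateCol_mul_replicateRow, dotProduct_single_one]

theorem det_one_add_mul_single [Fintype m] [Fintype n] [DecidableEq m] [DecidableEq n]
    (i : m) (j : n) (x : B) (c : Matrix n m B) :
    (1 + B.oddMul c (Matrix.single i j x)).det = 1 + B.ev (c j i * x) := by
  have h : B.oddMul c (Matrix.single i j x) = Matrix.replicateCol Unit (fun l => B.ev (c l i * x)) *
      Matrix.replicateRow Unit (Pi.single j (1 : B.grading 0)) := by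
    ext a l : 2
    rw [oddMul, Matrix.map_apply, Matrix.mul_apply, Matrix.mul_apply]
    simp only [Matrix.single_apply, mul_ite, mul_zero, Finset.univ_unique, Finset.sum_singleton,
      Matrix.replicateCol_apply, Matrix.replicateRow_apply, Pi.single_apply]
    by_cases h : j = l
    · subst h
      simp
    · simp [h, Ne.symm h, ev]
  rw [h, Matrix.det_one_add_replicateCol_mul_replicateRow, single_one_dotProduct]

/-- The Sylvester identity for odd matrices. -/
theorem det_one_add_oddMul_mul_det [Fintype m] [Fintype n] [DecidableEq m] [DecidableEq n]
    (h2 : (2 : k) ≠ 0) {b : Matrix m n B} (hb : B.EntriesIn 1 b) {c : Matrix n m B}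
    (hc : B.EntriesIn 1 c) : (1 + B.oddMul b c).det * (1 + B.oddMul c b).det = 1 := by
  -- Induction on `b` as a sum of matrix units. The entries are taken in the submodule of odd
  -- elements so that every summand stays odd, and `c` remains arbitrary because the additive step
  -- replaces it. No trace series is used, so no integer except 2 has to be nonzero in `k`.
  have key : ∀ b : Matrix m n (B.grading 1), ∀ c : Matrix n m B, B.EntriesIn 1 c →
      (1 + B.oddMul (b.map (B.grading 1).subtype) c).det *
        (1 + B.oddMul c (b.map (B.grading 1).subtype)).det = 1 := by
    intro b
    induction b using Matrix.induction_on' with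
    | h_zero =>
      intro c _
      rw [Matrix.map_zero _ (map_zero _)]
      have h1 : B.oddMul (0 : Matrix m n B) c = 0 := by
        ext; simp [oddMul, ev]
      have h2 : B.oddMul c (0 : Matrix m n B) = 0 := by
        ext; simp [oddMul, ev]
      simp [h1, h2]
    | h_std_basis i j x =>
      intro c hc
      rw [Matrix.map_single _ _ _ (B.grading 1).subtype, det_one_add_single_mul,
        det_one_add_mul_single]
      have hx : (x : B) ∈ B.grading 1 := x.2
      apply B.evenVal_injective
      rw [map_mul, map_add, map_add, map_one, Submodule.subtype_apply,
        B.evenVal_ev (B.odd_mul_odd_mem hx (hc j i)),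
        B.evenVal_ev (B.odd_mul_odd_mem (hc j i) hx), B.odd_mul_odd hx (hc j i)]
      -- The two determinants are `1 + t` and `1 - t` with `t = x c_{ji}`, and `t² = 0` because the
      -- square of the odd `c_{ji}` vanishes.
      have : (x : B) * c j i * (x * c j i) = 0 := by
        rw [mul_assoc, ← mul_assoc (c j i), B.odd_mul_odd hx (hc j i), neg_mul, mul_assoc (x : B),
          B.odd_mul_self h2 (hc j i), mul_zero, neg_zero, mul_zero]
      rw [mul_add, mul_one, mul_neg, add_mul, one_mul, this]
      abel
    | h_add b b' ihb ihb' =>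
      intro c hc
      rw [Matrix.map_add _ (map_add _)]
      have ob : B.EntriesIn 1 (b.map (B.grading 1).subtype) := fun i j => (b i j).2
      have ob' : B.EntriesIn 1 (b'.map (B.grading 1).subtype) := fun i j => (b' i j).2
      have ih := ihb c hc
      generalize b.map (B.grading 1).subtype = b at *
      generalize b'.map (B.grading 1).subtype = b' at *
      have hu : IsUnit (1 + B.oddMul b c).det := IsUnit.of_mul_eq_one _ ih
      set M := 1 + B.oddMul b c with hM
      set N := 1 + B.oddMul c b with hN
      have hMv : M.map B.evenVal = 1 + b * c := by
        rw [hM, map_evenVal_add, map_evenVal_one, map_oddMul ob hc]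
      have hNv : N.map B.evenVal = 1 + c * b := by
        rw [hN, map_evenVal_add, map_evenVal_one, map_oddMul hc ob]
      have hc' := hc.odd_mul_even M⁻¹
      -- The induction hypothesis for `b` makes `M = 1 + bc` invertible. It then splits off on the
      -- right here, and `N = 1 + cb` splits off on the left in `e2` because `N c = c M`. What
      -- remains is the identity for `b'` and `c M⁻¹`.
      have e1 : 1 + B.oddMul (b + b') c = (1 + B.oddMul b' (c * M⁻¹.map B.evenVal)) * M := by
        apply B.map_evenVal_injective
        simp only [map_evenVal_mul, map_evenVal_add, map_evenVal_one, map_oddMul (ob.add ob') hc,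
          map_oddMul ob' hc', Matrix.add_mul, Matrix.one_mul, Matrix.mul_assoc,
          B.inv_map_mul_map hu, Matrix.mul_one]
        rw [hMv, add_assoc]
      have e2 : 1 + B.oddMul c (b + b') = N * (1 + B.oddMul (c * M⁻¹.map B.evenVal) b') := by
        apply B.map_evenVal_injective
        have e3 : N.map B.evenVal * (c * M⁻¹.map B.evenVal) = c := by
          have e4 : N.map B.evenVal * c = c * M.map B.evenVal := by
            rw [hNv, hMv, Matrix.add_mul, Matrix.mul_add, Matrix.one_mul, Matrix.mul_one,
              Matrix.mul_assoc]
          rw [← Matrix.mul_assoc, e4, Matrix.mul_assoc, B.map_mul_inv_map hu, Matrix.mul_one]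
        simp only [map_evenVal_mul, map_evenVal_add, map_evenVal_one, map_oddMul hc (ob.add ob'),
          map_oddMul hc' ob', Matrix.mul_add, Matrix.mul_one]
        rw [← Matrix.mul_assoc, e3, hNv, add_assoc]
      rw [e1, e2, Matrix.det_mul, Matrix.det_mul]
      have := ihb' _ hc'
      linear_combination (M.det * N.det) * this + ih
  exact key (fun i j => ⟨b i j, hb i j⟩) c hc

end matrices

/-! ### Block supermatrices and multiplicativity of the Berezinian. -/

section blocks

variable {B : SuperCommAlg k} {r s : ℕ}

theorem ev_sub (x y : B) : B.ev (x - y) = B.ev x - B.ev y := by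
  rw [eq_sub_iff_add_eq, ← ev_add, sub_add_cancel]

theorem par_inr_add_par_inr {α β γ δ : Type} (i : β) (j : δ) :
    ((par (.inr i : α ⊕ β) + par (.inr j : γ ⊕ δ) : ℕ) : ZMod 2) = 0 := by
  change ((1 + 1 : ℕ) : ZMod 2) = 0
  decide

/-- The even supermatrix with the given blocks. -/
def superBlocks (A : Matrix (Fin r) (Fin r) (B.grading 0)) (b : Matrix (Fin r) (Fin s) B)
    (c : Matrix (Fin s) (Fin r) B) (D : Matrix (Fin s) (Fin s) (B.grading 0)) :
    Matrix (Fin r ⊕ Fin s) (Fin r ⊕ Fin s) B :=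
  Matrix.fromBlocks (A.map B.evenVal) b c (D.map B.evenVal)

variable {A : Matrix (Fin r) (Fin r) (B.grading 0)} {b : Matrix (Fin r) (Fin s) B}
    {c : Matrix (Fin s) (Fin r) B} {D : Matrix (Fin s) (Fin s) (B.grading 0)}

theorem isEvenMatrix_superBlocks (hb : B.EntriesIn 1 b) (hc : B.EntriesIn 1 c) :
    B.IsEvenMatrix (superBlocks A b c D) := by
  rintro (i | i) (j | j)
  · exact (A i j).2
  · exact hb i j
  · exact hc i j
  · rw [par_inr_add_par_inr]
    exact (D i j).2

theorem IsEvenMatrix.exists_superBlocks {W : Matrix (Fin r ⊕ Fin s) (Fin r ⊕ Fin s) B}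
    (hW : B.IsEvenMatrix W) : ∃ (A : Matrix (Fin r) (Fin r) (B.grading 0))
    (b : Matrix (Fin r) (Fin s) B) (c : Matrix (Fin s) (Fin r) B)
    (D : Matrix (Fin s) (Fin s) (B.grading 0)), B.EntriesIn 1 b ∧ B.EntriesIn 1 c ∧
      W = superBlocks A b c D :=
  ⟨fun i j => ⟨W (.inl i) (.inl j), hW (.inl i) (.inl j)⟩, W.toBlocks₁₂, W.toBlocks₂₁,
    fun i j => ⟨W (.inr i) (.inr j), by
      simpa only [par_inr_add_par_inr] using hW (.inr i) (.inr j)⟩,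
    fun i j => hW (.inl i) (.inr j), fun i j => hW (.inr i) (.inl j),
    (Matrix.fromBlocks_toBlocks W).symm⟩

theorem oddBlock_superBlocks : B.oddBlock (superBlocks A b c D) = D := by
  rw [oddBlock, superBlocks, Matrix.toBlocks_fromBlocks₂₂, map_ev_map_evenVal]

theorem schur_superBlocks :
    B.schur (superBlocks A b c D) = A - B.oddMul (b * D⁻¹.map B.evenVal) c := by
  rw [schur, oddBlock_superBlocks]
  ext i j : 1
  exact (ev_sub _ _).trans (congrArg (· - _) (B.ev_evenVal _))

theorem ber_superBlocks : B.ber (superBlocks A b c D) =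
    (A - B.oddMul (b * D⁻¹.map B.evenVal) c).det * Ring.inverse D.det := by
  rw [ber, schur_superBlocks, oddBlock_superBlocks]

theorem superBlocks_mul_lower {γ : Matrix (Fin s) (Fin r) B} (hb : B.EntriesIn 1 b)
    (hγ : B.EntriesIn 1 γ) : superBlocks A b c D * superBlocks 1 0 γ 1 =
      superBlocks (A + B.oddMul b γ) b (c + D.map B.evenVal * γ) D := by
  simp only [superBlocks, Matrix.fromBlocks_multiply, map_evenVal_one, Matrix.mul_one,
    Matrix.mul_zero, zero_add, map_evenVal_add, map_oddMul hb hγ]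

theorem superBlocks_mul_diag (a : Matrix (Fin r) (Fin r) (B.grading 0))
    (d : Matrix (Fin s) (Fin s) (B.grading 0)) : superBlocks A b c D * superBlocks a 0 0 d =
      superBlocks (A * a) (b * d.map B.evenVal) (c * a.map B.evenVal) (D * d) := by
  simp only [superBlocks, Matrix.fromBlocks_multiply, Matrix.mul_zero, zero_add, add_zero,
    map_evenVal_mul]

theorem superBlocks_mul_upper {β : Matrix (Fin r) (Fin s) B} (hc : B.EntriesIn 1 c)
    (hβ : B.EntriesIn 1 β) : superBlocks A b c D * superBlocks 1 β 0 1 =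
      superBlocks A (A.map B.evenVal * β + b) c (B.oddMul c β + D) := by
  simp only [superBlocks, Matrix.fromBlocks_multiply, map_evenVal_one, Matrix.mul_one,
    Matrix.mul_zero, add_zero, map_evenVal_add, map_oddMul hc hβ]

/-- Block Gauss elimination with pivot `D`. It reduces multiplicativity of the Berezinian to three
kinds of right factor. -/
theorem superBlocks_eq_mul (hb : B.EntriesIn 1 b) (hc : B.EntriesIn 1 c) (hD : IsUnit D.det) :
    superBlocks A b c D = superBlocks 1 (b * D⁻¹.map B.evenVal) 0 1 *
      superBlocks (A - B.oddMul (b * D⁻¹.map B.evenVal) c) 0 0 D *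
      superBlocks 1 0 (D⁻¹.map B.evenVal * c) 1 := by
  rw [superBlocks_mul_diag, Matrix.one_mul, Matrix.one_mul, Matrix.zero_mul, Matrix.mul_assoc,
    B.inv_map_mul_map hD, Matrix.mul_one,
    superBlocks_mul_lower hb (EntriesIn.even_mul_odd _ hc), zero_add, ← Matrix.mul_assoc,
    B.map_mul_inv_map hD, Matrix.one_mul]
  congr 1
  apply B.map_evenVal_injective
  simp only [map_evenVal_add, map_evenVal_sub, map_oddMul (hb.odd_mul_even _) hc,
    map_oddMul hb (EntriesIn.even_mul_odd _ hc), Matrix.mul_assoc, sub_add_cancel]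

/-- Right multiplication by `Y` preserves the invertibility of the odd-odd block, and multiplies the
Berezinian by `t`. -/
def RightBer (Y : Matrix (Fin r ⊕ Fin s) (Fin r ⊕ Fin s) B) (t : B.grading 0) : Prop :=
  ∀ X : Matrix (Fin r ⊕ Fin s) (Fin r ⊕ Fin s) B, B.IsEvenMatrix X → IsUnit (B.oddBlock X).det →
    B.IsEvenMatrix (X * Y) ∧ IsUnit (B.oddBlock (X * Y)).det ∧ B.ber (X * Y) = B.ber X * t

theorem RightBer.mul {Y Y' : Matrix (Fin r ⊕ Fin s) (Fin r ⊕ Fin s) B} {t t' : B.grading 0}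
    (h : RightBer Y t) (h' : RightBer Y' t') : RightBer (Y * Y') (t * t') := by
  intro X hX hu
  obtain ⟨h1, h2, h3⟩ := h X hX hu
  obtain ⟨h4, h5, h6⟩ := h' _ h1 h2
  rw [← Matrix.mul_assoc, ← mul_assoc, ← h3]
  exact ⟨h4, h5, h6⟩

/-- The blocks `b` and `D` do not move, while `A` and `c` gain `bγ` and `Dγ`, whose contributions to
the Schur complement cancel. -/
theorem rightBer_lower {γ : Matrix (Fin s) (Fin r) B} (hγ : B.EntriesIn 1 γ) :
    RightBer (superBlocks 1 0 γ 1) 1 := by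
  intro X hX hu
  obtain ⟨A, b, c, D, hb, hc, rfl⟩ := hX.exists_superBlocks
  rw [oddBlock_superBlocks] at hu
  have hc' := hc.add (EntriesIn.even_mul_odd D hγ)
  rw [superBlocks_mul_lower hb hγ, oddBlock_superBlocks, ber_superBlocks, ber_superBlocks, mul_one]
  refine ⟨isEvenMatrix_superBlocks hb hc', hu, ?_⟩
  congr 2
  apply B.map_evenVal_injective
  simp only [map_evenVal_add, map_evenVal_sub, map_oddMul (hb.odd_mul_even _) hc,
    map_oddMul hb hγ, map_oddMul (hb.odd_mul_even _) hc', Matrix.mul_add]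
  rw [← Matrix.mul_assoc _ _ γ, Matrix.mul_assoc b _ (D.map _), B.inv_map_mul_map hu, Matrix.mul_one,
    add_sub_add_right_eq_sub]

theorem rightBer_diag (a : Matrix (Fin r) (Fin r) (B.grading 0))
    {d : Matrix (Fin s) (Fin s) (B.grading 0)} (hd : IsUnit d.det) :
    RightBer (superBlocks a 0 0 d) (a.det * Ring.inverse d.det) := by
  intro X hX hu
  obtain ⟨A, b, c, D, hb, hc, rfl⟩ := hX.exists_superBlocks
  rw [oddBlock_superBlocks] at hu
  have hc' := hc.odd_mul_even a
  have hb' := hb.odd_mul_even d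
  rw [superBlocks_mul_diag, oddBlock_superBlocks, ber_superBlocks, ber_superBlocks, Matrix.det_mul]
  refine ⟨isEvenMatrix_superBlocks hb' hc', hu.mul hd, ?_⟩
  have e : A * a - B.oddMul (b * d.map B.evenVal * (D * d)⁻¹.map B.evenVal)
      (c * a.map B.evenVal) = (A - B.oddMul (b * D⁻¹.map B.evenVal) c) * a := by
    apply B.map_evenVal_injective
    simp only [map_evenVal_sub, map_oddMul (hb'.odd_mul_even _) hc']
    simp only [map_evenVal_sub, map_evenVal_mul, map_oddMul (hb.odd_mul_even _) hc,
      Matrix.mul_inv_rev, Matrix.sub_mul]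
    rw [← Matrix.mul_assoc _ (d⁻¹.map B.evenVal), Matrix.mul_assoc b (d.map _), B.map_mul_inv_map hd,
      Matrix.mul_one, Matrix.mul_assoc _ c]
  rw [e, Matrix.det_mul, Ring.mul_inverse_rev]
  ring

/-- This is the only factor that changes the pivot. With `κ = D⁻¹c`, the determinant of the odd
block is multiplied by `det (1 + κβ)` and that of the Schur complement is divided by `det (1 + βκ)`.
The odd Sylvester identity makes these two factors inverse to each other, so the quotient is
unchanged. -/
theorem rightBer_upper (h2 : (2 : k) ≠ 0) {β : Matrix (Fin r) (Fin s) B} (hβ : B.EntriesIn 1 β) :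
    RightBer (superBlocks 1 β 0 1) 1 := by
  intro X hX hu
  obtain ⟨A, b, c, D, hb, hc, rfl⟩ := hX.exists_superBlocks
  rw [oddBlock_superBlocks] at hu
  have hb' := (EntriesIn.even_mul_odd A hβ).add hb
  have hκ := EntriesIn.even_mul_odd D⁻¹ hc
  have hdet := det_one_add_oddMul_mul_det h2 hβ hκ
  rw [superBlocks_mul_upper hc hβ, oddBlock_superBlocks, ber_superBlocks, ber_superBlocks, mul_one]
  have eD : B.oddMul c β + D = D * (1 + B.oddMul (D⁻¹.map B.evenVal * c) β) := by
    apply B.map_evenVal_injective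
    simp only [map_evenVal_mul, map_evenVal_add, map_oddMul hκ hβ,
      map_oddMul hc hβ, Matrix.mul_add, Matrix.mul_one]
    rw [← Matrix.mul_assoc, ← Matrix.mul_assoc, B.map_mul_inv_map hu, Matrix.one_mul, add_comm]
  have hu' : IsUnit (B.oddMul c β + D).det := by
    rw [eD, Matrix.det_mul]
    exact hu.mul (IsUnit.of_mul_eq_one_right _ hdet)
  refine ⟨isEvenMatrix_superBlocks hb' hc, hu', ?_⟩
  have eS : (A - B.oddMul ((A.map B.evenVal * β + b) * (B.oddMul c β + D)⁻¹.map B.evenVal) c) *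
      (1 + B.oddMul β (D⁻¹.map B.evenVal * c)) = A - B.oddMul (b * D⁻¹.map B.evenVal) c := by
    apply B.map_evenVal_injective
    simp only [map_evenVal_mul, map_evenVal_add, map_evenVal_sub, map_evenVal_one,
      map_oddMul hβ hκ, map_oddMul (hb'.odd_mul_even _) hc, map_oddMul (hb.odd_mul_even _) hc]
    -- Both sides are `c + cβκ`. This moves `c` past the new pivot `cβ + D`, so that the inverse of
    -- the pivot cancels.
    have e1 : c * (1 + β * (D⁻¹.map B.evenVal * c)) =
        (B.oddMul c β + D).map B.evenVal * (D⁻¹.map B.evenVal * c) := by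
      rw [map_evenVal_add, map_oddMul hc hβ, Matrix.add_mul, Matrix.mul_add, Matrix.mul_one,
        ← Matrix.mul_assoc (D.map _), B.map_mul_inv_map hu, Matrix.one_mul, Matrix.mul_assoc,
        add_comm]
    rw [Matrix.sub_mul, Matrix.mul_assoc _ c, e1, Matrix.mul_assoc, ← Matrix.mul_assoc _ _ (_ * c),
      B.inv_map_mul_map hu', Matrix.one_mul, Matrix.mul_add, Matrix.mul_one, Matrix.add_mul,
      Matrix.mul_assoc _ β, Matrix.mul_assoc b]
    abel
  rw [← eS, Matrix.det_mul, eD, Matrix.det_mul, Ring.mul_inverse_rev]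
  have e3 : Ring.inverse (1 + B.oddMul (D⁻¹.map B.evenVal * c) β).det =
      (1 + B.oddMul β (D⁻¹.map B.evenVal * c)).det := by
    have hx := IsUnit.of_mul_eq_one_right _ hdet
    refine hx.mul_left_cancel ?_
    rw [Ring.mul_inverse_cancel _ hx, mul_comm, hdet]
  rw [e3]
  ring

theorem rightBer (h2 : (2 : k) ≠ 0) {Y : Matrix (Fin r ⊕ Fin s) (Fin r ⊕ Fin s) B}
    (hY : B.IsEvenMatrix Y) (hu : IsUnit (B.oddBlock Y).det) : RightBer Y (B.ber Y) := by
  obtain ⟨A, b, c, D, hb, hc, rfl⟩ := hY.exists_superBlocks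
  rw [oddBlock_superBlocks] at hu
  have h := ((rightBer_upper h2 (hb.odd_mul_even D⁻¹)).mul (rightBer_diag
    (A - B.oddMul (b * D⁻¹.map B.evenVal) c) hu)).mul
      (rightBer_lower (EntriesIn.even_mul_odd D⁻¹ hc))
  rw [← superBlocks_eq_mul hb hc hu] at h
  rw [ber_superBlocks]
  rwa [one_mul, mul_one] at h

theorem par_cast_add (a b c : ℕ) : (((a + b : ℕ) : ZMod 2) + ((b + c : ℕ) : ZMod 2)) =
    ((a + c : ℕ) : ZMod 2) := by
  push_cast
  have : (b : ZMod 2) + b = 0 := CharTwo.add_self_eq_zero _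
  linear_combination this

theorem IsEvenMatrix.mul {α β γ δ ι κ : Type} [Fintype γ] [Fintype δ]
    {P : Matrix (α ⊕ β) (γ ⊕ δ) B} {Q : Matrix (γ ⊕ δ) (ι ⊕ κ) B} (hP : B.IsEvenMatrix P)
    (hQ : B.IsEvenMatrix Q) : B.IsEvenMatrix (P * Q) := by
  intro a i
  rw [Matrix.mul_apply]
  refine Submodule.sum_mem _ fun j _ => ?_
  rw [← par_cast_add (par a) (par j) (par i)]
  exact SetLike.mul_mem_graded (hP a j) (hQ j i)

theorem isEvenMatrix_one : B.IsEvenMatrix (1 : Matrix (Fin r ⊕ Fin s) (Fin r ⊕ Fin s) B) := by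
  intro i j
  by_cases h : i = j
  · subst h
    rw [Matrix.one_apply_eq, Nat.cast_add, CharTwo.add_self_eq_zero]
    exact SetLike.one_mem_graded B.grading
  · rw [Matrix.one_apply_ne h]
    exact Submodule.zero_mem _

/-- The inverse of an even supermatrix is even. -/
theorem IsEvenMatrix.of_mul_eq_one {g h : Matrix (Fin r ⊕ Fin s) (Fin r ⊕ Fin s) B}
    (hg : B.IsEvenMatrix g) (hgh : g * h = 1) (hhg : h * g = 1) : B.IsEvenMatrix h := by
  let h' : Matrix (Fin r ⊕ Fin s) (Fin r ⊕ Fin s) B :=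
    fun i j => decompose B.grading (h i j) ((par i + par j : ℕ) : ZMod 2)
  -- Since `g` is even, multiplication by it commutes with the projection of each entry to its
  -- prescribed parity, and `1` is fixed by that projection. Uniqueness of inverses then forces `h'
  -- = h`.
  have e : g * h' = 1 := by
    ext i j
    have e1 := isEvenMatrix_one (B := B) i j
    have e2 := congrFun (congrFun hgh i) j
    rw [← e2, Matrix.mul_apply] at e1
    rw [← e2, Matrix.mul_apply, Matrix.mul_apply, ← decompose_of_mem_same B.grading e1,
      decompose_sum, DFinsupp.finsetSum_apply, AddSubmonoidClass.coe_finsetSum]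
    refine Finset.sum_congr rfl fun t _ => ?_
    rw [← par_cast_add (par i) (par t) (par j),
      coe_decompose_mul_add_of_left_mem B.grading (hg i t)]
  have e3 : h' = h := by
    rw [← Matrix.one_mul h', ← hhg, Matrix.mul_assoc, e, Matrix.mul_one]
  rw [← e3]
  exact fun i j => SetLike.coe_mem _

theorem IsEvenMatrix.isUnit_det_oddBlock (h2 : (2 : k) ≠ 0)
    {g : Matrix (Fin r ⊕ Fin s) (Fin r ⊕ Fin s) B} (hg : B.IsEvenMatrix g) (hu : IsUnit g) :
    IsUnit (B.oddBlock g).det := by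
  obtain ⟨⟨g, h, hgh, hhg⟩, rfl⟩ := hu
  change B.IsEvenMatrix g at hg
  change IsUnit (B.oddBlock g).det
  have hh := hg.of_mul_eq_one hgh hhg
  obtain ⟨A, b, c, D, hb, hc, rfl⟩ := hg.exists_superBlocks
  obtain ⟨A', b', c', D', hb', hc', rfl⟩ := hh.exists_superBlocks
  rw [oddBlock_superBlocks]
  rw [superBlocks, superBlocks, Matrix.fromBlocks_multiply, ← Matrix.fromBlocks_one,
    Matrix.fromBlocks_inj] at hgh
  -- The odd-odd block of `g h = 1` reads `c b' + D D' = 1`. The determinant of `1 - c b'` is a unit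
  -- by the odd Sylvester identity.
  have e : D * D' = 1 + B.oddMul (-c) b' := by
    apply B.map_evenVal_injective
    simp only [map_evenVal_mul, map_evenVal_add, map_evenVal_one, map_oddMul hc.neg hb',
      Matrix.neg_mul]
    rw [← hgh.2.2.2]
    abel
  have h3 := IsUnit.of_mul_eq_one_right _ (det_one_add_oddMul_mul_det h2 hb' hc.neg)
  rw [← e, Matrix.det_mul] at h3
  exact isUnit_of_mul_isUnit_left h3

end blocks

/-! ### First and second derivatives of the Berezinian along columns. -/

section columns

variable {B : SuperCommAlg k} {r s : ℕ} {ι κ : Type*}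

/-- The element `a + ε b` of `B[ε]`. -/
def epsMk (q : ZMod 2) (a b : B) : B.eps q := (⟨a, b⟩ : Eps B q)

/-- The coefficient of `ε`. -/
def epsSnd (B : SuperCommAlg k) (q : ZMod 2) : B.eps q →+ B where
  toFun x := Eps.snd x
  map_zero' := rfl
  map_add' _ _ := rfl

theorem eps_ext {q : ZMod 2} {x y : B.eps q} (h : B.epsProj q x = B.epsProj q y)
    (h' : B.epsSnd q x = B.epsSnd q y) : x = y := Eps.ext h h'

@[simp] theorem epsProj_epsMk (q : ZMod 2) (a b : B) : B.epsProj q (epsMk q a b) = a := rfl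

@[simp] theorem epsSnd_epsMk (q : ZMod 2) (a b : B) : B.epsSnd q (epsMk q a b) = b := rfl

@[simp] theorem epsProj_epsIncl (q : ZMod 2) (a : B) : B.epsProj q (B.epsIncl q a) = a := rfl

@[simp] theorem epsSnd_epsIncl (q : ZMod 2) (a : B) : B.epsSnd q (B.epsIncl q a) = 0 := rfl

@[simp] theorem epsSnd_one (q : ZMod 2) : B.epsSnd q 1 = 0 := rfl

theorem epsSnd_mul {q : ZMod 2} (x y : B.eps q) : B.epsSnd q (x * y) =
    B.epsSnd q x * B.epsProj q y + B.twist q (B.epsProj q x) * B.epsSnd q y := rfl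

theorem epsSnd_neg_one_pow_mul {q : ZMod 2} (e : ℕ) (x : B.eps q) :
    B.epsSnd q ((-1) ^ e * x) = (-1) ^ e * B.epsSnd q x := by
  rcases neg_one_pow_eq_or ℤ e with h | h
  · have h1 : ∀ C : SuperCommAlg k, (-1 : C) ^ e = 1 := fun C => by
      exact_mod_cast congrArg (Int.cast : ℤ → C) h
    simp [h1]
  · have h1 : ∀ C : SuperCommAlg k, (-1 : C) ^ e = -1 := fun C => by
      exact_mod_cast congrArg (Int.cast : ℤ → C) h
    simp [h1]

theorem twist_neg (q : ZMod 2) (x : B) : B.twist q (-x) = -B.twist q x := by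
  rw [eq_neg_iff_add_eq_zero, ← twist_add, neg_add_cancel, Eps.twist_zero']

theorem twist_of_even (q : ZMod 2) {x : B} (hx : x ∈ B.grading 0) : B.twist q x = x := by
  simpa using B.twist_of_mem q 0 hx

/-- The automorphism `x ↦ (-1)^{q|x|} x`, as an additive map. -/
def twistHom (B : SuperCommAlg k) (q : ZMod 2) : B →+ B where
  toFun := B.twist q
  map_zero' := Eps.twist_zero'
  map_add' := B.twist_add q

/-- The matrix `W + x ε` over `B[ε]`, where the column vector `x` is placed in column `i`. -/
def colShift [DecidableEq κ] (q : ZMod 2) (W : Matrix ι κ B) (i : κ) (x : ι → B) :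
    Matrix ι κ (B.eps q) :=
  fun l j => epsMk q (W l j) (if j = i then B.twist q (x l) else 0)

/-- Writing `ε` to the right of the column makes the shift compatible with left multiplication
without any sign. The `twist` in `colShift` is the cost of bringing `ε` back to the left. -/
theorem map_mul_colShift {μ : Type*} [DecidableEq κ] [Fintype μ] (q : ZMod 2) (M : Matrix ι μ B)
    (Q : Matrix μ κ B) (i : κ) (z : μ → B) :
    M.map (B.epsIncl q) * colShift q Q i z = colShift q (M * Q) i (M.mulVec z) := by
  ext l j
  rw [Matrix.mul_apply]
  refine eps_ext ?_ ?_
  · rw [map_sum]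
    rfl
  · rw [map_sum]
    change ∑ t, (0 * Q t j + B.twist q (M l t) * if j = i then B.twist q (z t) else 0) =
      if j = i then B.twistHom q (∑ t, M l t * z t) else 0
    split_ifs
    · rw [map_sum]
      refine Finset.sum_congr rfl fun t _ => ?_
      rw [zero_mul, zero_add]
      exact (B.twist_mul q _ _).symm
    · simp

theorem colShift_map_eps {C : SuperCommAlg k} (f : Hom B C) [DecidableEq κ] (q : ZMod 2)
    (W : Matrix ι κ B) (i : κ) (x : ι → B) :
    (colShift q W i x).map (f.eps q) = colShift q (W.map f) i (fun l => f (x l)) := by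
  ext l j
  refine Eps.ext rfl ?_
  change f (if j = i then B.twist q (x l) else 0) = if j = i then C.twist q (f (x l)) else 0
  split_ifs
  · exact f.map_twist q _
  · exact map_zero f.toAlgHom

variable {W W' : Matrix (Fin r ⊕ Fin s) (Fin r ⊕ Fin s) B}

theorem IsEvenMatrix.colShift (hW : B.IsEvenMatrix W) (α : ℕ) (i : Fin r ⊕ Fin s)
    {x : Fin r ⊕ Fin s → B} (hx : ∀ l, x l ∈ B.grading ((par l + α : ℕ) : ZMod 2)) :
    (B.eps ((α + par i : ℕ) : ZMod 2)).IsEvenMatrix (colShift ((α + par i : ℕ) : ZMod 2) W i x) := by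
  intro l j
  refine ⟨hW l j, ?_⟩
  change (if j = i then B.twist _ (x l) else 0) ∈ _
  split_ifs with h
  · subst h
    rw [Nat.add_comm α, par_cast_add]
    exact B.twist_mem _ _ (hx l)
  · exact Submodule.zero_mem _

theorem isUnit_det_oddBlock_colShift (hu : IsUnit (B.oddBlock W).det) (q : ZMod 2)
    (i : Fin r ⊕ Fin s) (x : Fin r ⊕ Fin s → B) :
    IsUnit ((B.eps q).oddBlock (colShift q W i x)).det := by
  apply isUnit_of_isUnit_fst
  rw [← (B.epsProj q).map_det_oddBlock]
  exact hu

theorem ber_colShift_fst (hu : IsUnit (B.oddBlock W).det) (q : ZMod 2)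
    (i : Fin r ⊕ Fin s) (x : Fin r ⊕ Fin s → B) :
    B.epsProj q ((B.eps q).ber (colShift q W i x)) = B.ber W :=
  (congrArg Subtype.val ((B.epsProj q).map_ber _ (isUnit_det_oddBlock_colShift hu q i x))).symm

theorem ev_zero : B.ev 0 = 0 := by simp [ev]

theorem ev_one : B.ev 1 = 1 := by simpa using B.ev_evenVal 1

/-- A change in an even column leaves the odd-odd block `1` and the even-odd block `0`, so only a
rank one determinant in the numerator survives. For an odd column it is in the denominator, which is
the source of the supertrace sign in `ber_colShift_one`. -/
theorem ber_one_add_col_inl (i : Fin r) (ζ : Fin r ⊕ Fin s → B) :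
    B.ber (1 + Matrix.of fun l j => if j = Sum.inl i then ζ l else 0) = 1 + B.ev (ζ (.inl i)) := by
  set N : Matrix (Fin r ⊕ Fin s) (Fin r ⊕ Fin s) B :=
    1 + Matrix.of fun l j => if j = Sum.inl i then ζ l else 0 with hN
  have h22 : B.oddBlock N = 1 := by
    ext l j : 1
    rw [oddBlock, Matrix.map_apply, Matrix.toBlocks₂₂, Matrix.of_apply, hN]
    by_cases h : l = j
    · subst h; simp [ev_one]
    · simp [Matrix.one_apply_ne h, ev_zero, h]
  have h12 : N.toBlocks₁₂ = 0 := by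
    ext l j
    rw [Matrix.toBlocks₁₂, Matrix.of_apply, hN]
    simp
  have hS : B.schur N = 1 + Matrix.replicateCol Unit (fun l => B.ev (ζ (.inl l))) *
      Matrix.replicateRow Unit (Pi.single i (1 : B.grading 0)) := by
    rw [schur, h12, Matrix.zero_mul, Matrix.zero_mul, sub_zero]
    ext l j : 1
    rw [Matrix.map_apply, Matrix.toBlocks₁₁, Matrix.of_apply, hN, Matrix.add_apply, ev_add,
      Matrix.add_apply, Matrix.mul_apply]
    congr 1
    · by_cases h : l = j
      · subst h; simp [ev_one]
      · simp [Matrix.one_apply_ne h, ev_zero, h]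
    · by_cases h : j = i
      · subst h; simp
      · simp [h, ev_zero]
  rw [ber, hS, h22, Matrix.det_one_add_replicateCol_mul_replicateRow, single_one_dotProduct]
  simp

theorem ber_one_add_col_inr (i : Fin s) (ζ : Fin r ⊕ Fin s → B) :
    B.ber (1 + Matrix.of fun l j => if j = Sum.inr i then ζ l else 0) =
      Ring.inverse (1 + B.ev (ζ (.inr i))) := by
  set N : Matrix (Fin r ⊕ Fin s) (Fin r ⊕ Fin s) B :=
    1 + Matrix.of fun l j => if j = Sum.inr i then ζ l else 0 with hN
  have hS : B.schur N = 1 := by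
    have h21 : N.toBlocks₂₁ = 0 := by
      ext l j
      rw [Matrix.toBlocks₂₁, Matrix.of_apply, hN]
      simp
    rw [schur, h21, Matrix.mul_zero, sub_zero]
    ext l j : 1
    rw [Matrix.map_apply, Matrix.toBlocks₁₁, Matrix.of_apply, hN]
    by_cases h : l = j
    · subst h; simp [ev_one]
    · simp [Matrix.one_apply_ne h, ev_zero, h]
  have h22 : B.oddBlock N = 1 + Matrix.replicateCol Unit (fun l => B.ev (ζ (.inr l))) *
      Matrix.replicateRow Unit (Pi.single i (1 : B.grading 0)) := by
    ext l j : 1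
    rw [oddBlock, Matrix.map_apply, Matrix.toBlocks₂₂, Matrix.of_apply, hN, Matrix.add_apply,
      ev_add, Matrix.add_apply, Matrix.mul_apply]
    congr 1
    · by_cases h : l = j
      · subst h; simp [ev_one]
      · simp [Matrix.one_apply_ne h, ev_zero, h]
    · by_cases h : j = i
      · subst h; simp
      · simp [h, ev_zero]
  rw [ber, hS, h22, Matrix.det_one_add_replicateCol_mul_replicateRow, single_one_dotProduct]
  simp

theorem colShift_one (q : ZMod 2) (i : Fin r ⊕ Fin s) (z : Fin r ⊕ Fin s → B) :
    colShift q 1 i z = 1 + Matrix.of fun l j =>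
      if j = i then epsMk q 0 (B.twist q (z l)) else 0 := by
  ext l j
  rw [Matrix.add_apply, Matrix.of_apply]
  refine eps_ext ?_ ?_
  · rw [map_add, Matrix.one_apply, apply_ite (B.epsProj q), apply_ite (B.epsProj q)]
    simp [colShift, Matrix.one_apply]
  · rw [map_add, Matrix.one_apply, apply_ite (B.epsSnd q), apply_ite (B.epsSnd q)]
    simp [colShift]

theorem ber_colShift_one (q : ZMod 2) (i : Fin r ⊕ Fin s) (z : Fin r ⊕ Fin s → B)
    (hz : z i ∈ B.grading q) : ((B.eps q).ber (colShift q 1 i z) : B.eps q) =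
      epsMk q 1 ((-1) ^ par i * B.twist q (z i)) := by
  have hmem : epsMk q 0 (B.twist q (z i)) ∈ (B.eps q).grading 0 :=
    ⟨Submodule.zero_mem _, by rw [zero_add]; exact B.twist_mem q q hz⟩
  have hev := (B.eps q).evenVal_ev hmem
  rw [colShift_one]
  rcases i with i | i
  · rw [ber_one_add_col_inl]
    change (B.eps q).evenVal (1 + _) = _
    rw [map_add, map_one, hev]
    refine eps_ext ?_ ?_ <;> simp [par]
  · rw [ber_one_add_col_inr]
    set t := (B.eps q).ev (epsMk q 0 (B.twist q (z (.inr i)))) with ht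
    -- As `t` is a multiple of `ε`, the inverse of `1 + t` is `1 - t`.
    have htt : t * t = 0 := by
      apply (B.eps q).evenVal_injective
      rw [map_mul, hev, map_zero]
      refine eps_ext ?_ ?_ <;> simp [epsSnd_mul, Eps.twist_zero']
    have hinv : (1 + t) * (1 - t) = 1 := by linear_combination -htt
    have : Ring.inverse (1 + t) = 1 - t := by
      have hu := IsUnit.of_mul_eq_one _ hinv
      refine hu.mul_left_cancel ?_
      rw [Ring.mul_inverse_cancel _ hu, hinv]
    rw [this]
    change (B.eps q).evenVal (1 - t) = _
    rw [map_sub, map_one, hev]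
    refine eps_ext ?_ ?_ <;> simp [par]

/-- The left derivative of the Berezinian at `W`, in the direction of the column vector `x` of
parity `α` placed in column `i`. -/
noncomputable def berDeriv (α : ℕ) (i : Fin r ⊕ Fin s) (x : Fin r ⊕ Fin s → B)
    (W : Matrix (Fin r ⊕ Fin s) (Fin r ⊕ Fin s) B) : B :=
  B.epsSnd ((α + par i : ℕ) : ZMod 2)
    ((B.eps ((α + par i : ℕ) : ZMod 2)).ber (colShift ((α + par i : ℕ) : ZMod 2) W i x))

/-- The second left derivative of the Berezinian: first in the direction `(β, j, y)`, then in the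
direction `(α, i, x)`. -/
noncomputable def berDeriv₂ (α : ℕ) (i : Fin r ⊕ Fin s) (x : Fin r ⊕ Fin s → B)
    (β : ℕ) (j : Fin r ⊕ Fin s) (y : Fin r ⊕ Fin s → B)
    (W : Matrix (Fin r ⊕ Fin s) (Fin r ⊕ Fin s) B) : B :=
  B.epsSnd ((α + par i : ℕ) : ZMod 2)
    (berDeriv β j (fun l => B.epsIncl ((α + par i : ℕ) : ZMod 2) (y l))
      (colShift ((α + par i : ℕ) : ZMod 2) W i x))

theorem mulVec_mem (hW : B.IsEvenMatrix W) {α : ℕ} {x : Fin r ⊕ Fin s → B}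
    (hx : ∀ l, x l ∈ B.grading ((par l + α : ℕ) : ZMod 2)) (l : Fin r ⊕ Fin s) :
    W.mulVec x l ∈ B.grading ((par l + α : ℕ) : ZMod 2) := by
  rw [Matrix.mulVec, dotProduct]
  refine Submodule.sum_mem _ fun t _ => ?_
  rw [← par_cast_add (par l) (par t) α]
  exact SetLike.mul_mem_graded (hW l t) (hx t)

theorem neg_one_pow_val (n : ℕ) : (-1 : B) ^ ((n : ZMod 2).val) = (-1) ^ n := by
  rw [ZMod.val_natCast, ← neg_one_pow_eq_pow_mod_two]

theorem neg_one_pow_val_mul_val (n l : ℕ) :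
    (-1 : B) ^ ((n : ZMod 2).val * (l : ZMod 2).val) = (-1) ^ (n * l) := by
  rw [pow_mul, neg_one_pow_val, ← pow_mul, mul_comm, pow_mul, neg_one_pow_val, ← pow_mul, mul_comm]

theorem neg_one_pow_congr {e f : ℕ} (h : (e : ZMod 2) = f) : (-1 : B) ^ e = (-1) ^ f := by
  rw [← neg_one_pow_val, h, neg_one_pow_val]

/-- The logarithmic derivative of the Berezinian at an invertible matrix. -/
theorem berDeriv_eq (h2 : (2 : k) ≠ 0) (hW : B.IsEvenMatrix W) (h : W * W' = 1) (h' : W' * W = 1)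
    (α : ℕ) (i : Fin r ⊕ Fin s) {x : Fin r ⊕ Fin s → B}
    (hx : ∀ l, x l ∈ B.grading ((par l + α : ℕ) : ZMod 2)) :
    berDeriv α i x W = (-1) ^ α * ((B.ber W : B) * W'.mulVec x i) := by
  have hu := hW.isUnit_det_oddBlock h2 ⟨⟨W, W', h, h'⟩, rfl⟩
  have hW' := hW.of_mul_eq_one h h'
  have hz := mulVec_mem hW' hx
  unfold berDeriv
  have hzi := hz i
  set z := W'.mulVec x with hzdef
  have hxz : x = W.mulVec z := by rw [hzdef, Matrix.mulVec_mulVec, h, Matrix.one_mulVec]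
  -- `W + xε = W (1 + zε)` with `z = W⁻¹x`, so multiplicativity reduces the derivative at `W` to
  -- that at `1`.
  have e : ∀ q : ZMod 2, colShift q W i x = W.map (B.epsIncl q) * colShift q 1 i z := by
    intro q
    rw [map_mul_colShift, Matrix.mul_one, ← hxz]
  have hone := isUnit_det_oddBlock_colShift (W := (1 : Matrix (Fin r ⊕ Fin s) (Fin r ⊕ Fin s) B))
    (isEvenMatrix_one.isUnit_det_oddBlock h2 isUnit_one) ((α + par i : ℕ) : ZMod 2) i z
  -- Here `z_i` has the parity of `ε`, and `q² = q` modulo 2. Together with the supertrace sign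
  -- `(-1)^{par i}` this leaves `(-1)^α`.
  have hsgn : B.twist ((α + par i : ℕ) : ZMod 2) (z i) = (-1) ^ (α + par i) * z i := by
    rw [B.twist_of_mem _ _ hzi, Nat.add_comm (par i), neg_one_pow_val_mul_val]
    congr 1
    apply neg_one_pow_congr
    push_cast
    have : ∀ x : ZMod 2, x * x = x := by decide
    exact this _
  rw [add_comm] at hzi
  generalize hq : ((α + par i : ℕ) : ZMod 2) = q at hone hzi hsgn ⊢
  have heven : (B.eps q).IsEvenMatrix (colShift q 1 i z) := by
    rw [← hq]
    exact isEvenMatrix_one.colShift α i hz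
  have hWe : (B.eps q).IsEvenMatrix (W.map (B.epsIncl q)) :=
    fun l j => (B.epsIncl q).map_mem _ _ (hW l j)
  have hWu : IsUnit ((B.eps q).oddBlock (W.map (B.epsIncl q))).det := by
    rw [(B.epsIncl q).map_det_oddBlock]
    exact hu.map _
  rw [e, (rightBer h2 heven hone _ hWe hWu).2.2, (B.epsIncl q).map_ber _ hu]
  change B.epsSnd q (B.epsIncl q (B.ber W) *
    ((B.eps q).ber (colShift q 1 i z) : B.eps q)) = _
  rw [ber_colShift_one q i z hzi, epsSnd_mul, epsSnd_epsIncl, epsSnd_epsMk, epsProj_epsIncl,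
    B.twist_of_even q (B.ber W).2, hsgn, zero_mul, zero_add, ← mul_assoc _ _ (z i), ← pow_add,
    neg_one_pow_congr (B := B) (e := par i + (α + par i)) (f := α)]
  · rcases neg_one_pow_eq_or B α with h | h <;> simp [h]
  · push_cast
    linear_combination CharTwo.add_self_eq_zero (par i : ZMod 2)

/-- The quadratic term contains `ε` twice and vanishes. -/
theorem colShift_one_mul_colShift_one_neg (q : ZMod 2) (i : Fin r ⊕ Fin s)
    (z : Fin r ⊕ Fin s → B) : colShift q 1 i z * colShift q 1 i (-z) = 1 := by
  ext l j
  rw [Matrix.mul_apply]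
  refine eps_ext ?_ ?_
  · rw [map_sum, Matrix.one_apply, apply_ite (B.epsProj q), map_one, map_zero]
    change ∑ t, (1 : Matrix _ _ B) l t * (1 : Matrix _ _ B) t j = _
    rw [← Matrix.mul_apply, Matrix.one_mul, Matrix.one_apply]
  · have e0 : B.epsSnd q ((1 : Matrix (Fin r ⊕ Fin s) (Fin r ⊕ Fin s) (B.eps q)) l j) = 0 := by
      rw [Matrix.one_apply, apply_ite (B.epsSnd q)]
      exact ite_self _
    rw [map_sum]
    change ∑ t, ((if t = i then B.twist q (z l) else 0) * (1 : Matrix _ _ B) t j +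
      B.twist q ((1 : Matrix _ _ B) l t) * if j = i then B.twist q (-z t) else 0) = _
    rw [e0, Finset.sum_add_distrib]
    have e1 : ∑ t, (if t = i then B.twist q (z l) else 0) * (1 : Matrix _ _ B) t j =
        if j = i then B.twist q (z l) else 0 := by
      simp [Matrix.one_apply]
    have e2 : ∑ t, B.twist q ((1 : Matrix _ _ B) l t) * (if j = i then B.twist q (-z t) else 0) =
        if j = i then -B.twist q (z l) else 0 := by
      rw [Finset.sum_eq_single l]
      · simp [Eps.twist_one', twist_neg]
      · intro t _ ht
        rw [Matrix.one_apply_ne ht.symm, Eps.twist_zero', zero_mul]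
      · simp
    rw [e1, e2]
    split_ifs <;> simp

/-- The first derivative formula is applied over `B[ε]` to `W + xε`, whose inverse is `(1 - zε) W⁻¹`
with `z = W⁻¹x`. In the coefficient of `ε`, the Berezinian contributes the first product in the
bracket and the varying inverse contributes the second. -/
theorem berDeriv₂_eq (h2 : (2 : k) ≠ 0) (hW : B.IsEvenMatrix W) (h : W * W' = 1) (h' : W' * W = 1)
    (α β : ℕ) (i j : Fin r ⊕ Fin s) {x y : Fin r ⊕ Fin s → B}
    (hx : ∀ l, x l ∈ B.grading ((par l + α : ℕ) : ZMod 2))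
    (hy : ∀ l, y l ∈ B.grading ((par l + β : ℕ) : ZMod 2)) :
    berDeriv₂ α i x β j y W = (-1) ^ (α + β) * ((B.ber W : B) *
      (W'.mulVec x i * W'.mulVec y j - (-1) ^ (par i * par j + α * (par i + par j)) *
        (W'.mulVec x j * W'.mulVec y i))) := by
  have hu := hW.isUnit_det_oddBlock h2 ⟨⟨W, W', h, h'⟩, rfl⟩
  have hW' := hW.of_mul_eq_one h h'
  have hz := mulVec_mem hW' hx
  have hD := berDeriv_eq h2 hW h h' α i hx
  have hWs := hW.colShift α i hx
  have hxz : x = W.mulVec (W'.mulVec x) := by rw [Matrix.mulVec_mulVec, h, Matrix.one_mulVec]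
  -- Modulo 2, `(α + i)(j + α) = α + ij + α(i + j)`: passing `ε` through `z_j` produces the sign of
  -- the equations up to `(-1)^α`.
  have hsgn : B.twist ((α + par i : ℕ) : ZMod 2) (W'.mulVec x j) =
      (-1) ^ α * ((-1) ^ (par i * par j + α * (par i + par j)) * W'.mulVec x j) := by
    rw [B.twist_of_mem _ _ (hz j), neg_one_pow_val_mul_val, ← mul_assoc, ← pow_add]
    congr 1
    apply neg_one_pow_congr
    push_cast
    have : ∀ a i j : ZMod 2, (a + i) * (j + a) = a + (i * j + a * (i + j)) := by decide
    exact this _ _ _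
  unfold berDeriv₂
  unfold berDeriv at hD
  generalize hq : ((α + par i : ℕ) : ZMod 2) = q at hWs hsgn hD ⊢
  set V := W'.map (B.epsIncl q) with hV
  have hincl : ∀ {M N : Matrix (Fin r ⊕ Fin s) (Fin r ⊕ Fin s) B}, M * N = 1 →
      M.map (B.epsIncl q) * N.map (B.epsIncl q) = 1 := by
    intro M N hMN
    rw [← Matrix.map_mul, hMN, Matrix.map_one _ (map_zero _) (map_one _)]
  have eW : colShift q W i x = W.map (B.epsIncl q) * colShift q 1 i (W'.mulVec x) := by
    rw [map_mul_colShift, Matrix.mul_one, ← hxz]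
  have eN := colShift_one_mul_colShift_one_neg q i (W'.mulVec x)
  have eN' := colShift_one_mul_colShift_one_neg q i (-W'.mulVec x)
  rw [neg_neg] at eN'
  have i1 : colShift q W i x * (colShift q 1 i (-W'.mulVec x) * V) = 1 := by
    rw [eW, Matrix.mul_assoc, ← Matrix.mul_assoc _ _ V, eN, Matrix.one_mul, hincl h]
  have i2 : (colShift q 1 i (-W'.mulVec x) * V) * colShift q W i x = 1 := by
    rw [eW, Matrix.mul_assoc, ← Matrix.mul_assoc V, hincl h', Matrix.one_mul, eN']
  rw [berDeriv_eq h2 hWs i1 i2 β j (fun l => (B.epsIncl q).map_mem _ _ (hy l))]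
  have eV : V.mulVec (fun l => B.epsIncl q (y l)) = fun l => B.epsIncl q (W'.mulVec y l) := by
    ext l
    simp only [hV, Matrix.mulVec, dotProduct, map_sum, map_mul, Matrix.map_apply]
  have eζ : (colShift q 1 i (-W'.mulVec x)).mulVec (fun l => B.epsIncl q (W'.mulVec y l)) j =
      epsMk q (W'.mulVec y j) (-(B.twist q (W'.mulVec x j) * W'.mulVec y i)) := by
    rw [Matrix.mulVec, dotProduct]
    refine eps_ext ?_ ?_
    · rw [map_sum]
      change ∑ t, (1 : Matrix _ _ B) j t * W'.mulVec y t = _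
      simp [Matrix.one_apply]
    · rw [map_sum]
      change ∑ t, ((if t = i then B.twist q (-W'.mulVec x j) else 0) * W'.mulVec y t +
        B.twist q ((1 : Matrix _ _ B) j t) * 0) = _
      simp [twist_neg]
  rw [← Matrix.mulVec_mulVec, eV, eζ, epsSnd_neg_one_pow_mul, epsSnd_mul, ber_colShift_fst hu, hD,
    epsProj_epsMk, epsSnd_epsMk, B.twist_of_even q (B.ber W).2, hsgn, pow_add _ α β]
  rcases neg_one_pow_eq_or B α with h | h <;> rcases neg_one_pow_eq_or B β with h' | h' <;>
  rcases neg_one_pow_eq_or B (par i * par j + α * (par i + par j)) with h'' | h'' <;>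
  rw [h, h', h''] <;> noncomm_ring

end columns

/-! ### The superalgebras `B[z]` and `B[[z]]`. -/

section coefficients

theorem ext_component {B : SuperCommAlg k} {x : B} (h0 : x ∈ B.grading 0) (h1 : x ∈ B.grading 1) :
    x = 0 := by
  rw [← decompose_of_mem_same B.grading h0, decompose_of_mem_ne B.grading h1 (by decide)]

/-- A ring of series with coefficients in `B`, graded coefficientwise. -/
noncomputable def ofCoeff (B : SuperCommAlg k) (C : Type u) [Ring C] [Algebra k C]
    (coef : ℕ → C →ₗ[k] B)
    (inj : ∀ x y, (∀ n, coef n x = coef n y) → x = y)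
    (one : ∀ n, coef n 1 = if n = 0 then 1 else 0)
    (mul : ∀ n x y, coef n (x * y) =
      ∑ p ∈ Finset.HasAntidiagonal.antidiagonal n, coef p.1 x * coef p.2 y)
    (comp : ∀ x, ∃ y, ∀ n, coef n y = decompose B.grading (coef n x) 0) : SuperCommAlg k :=
  let G : ZMod 2 → Submodule k C := fun i => ⨅ n, (B.grading i).comap (coef n)
  have mem : ∀ {i x}, x ∈ G i ↔ ∀ n, coef n x ∈ B.grading i := by
    intro i x
    simp [G, Submodule.mem_iInf]
  -- A decomposition indexed by `ZMod 2` amounts to a pair of complementary submodules. The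
  -- hypothesis `comp` says that taking even components of all coefficients does not leave `C`.
  have compl : IsCompl (G 0) (G 1) := by
    constructor
    · rw [Submodule.disjoint_def]
      intro x h0 h1
      refine inj x 0 fun n => ?_
      rw [map_zero]
      exact ext_component (mem.mp h0 n) (mem.mp h1 n)
    · rw [codisjoint_iff, eq_top_iff]
      intro x _
      obtain ⟨y, hy⟩ := comp x
      refine Submodule.mem_sup.mpr ⟨y, ?_, x - y, ?_, by abel⟩
      · rw [mem]
        intro n
        rw [hy]
        exact SetLike.coe_mem _
      · rw [mem]
        intro n
        rw [map_sub, hy, sub_eq_of_eq_add' (B.decompose_add_eq (coef n x)).symm]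
        exact SetLike.coe_mem _
  { carrier := C
    grading := G
    graded :=
      { one_mem := by
          rw [mem]
          intro n
          rw [one]
          split_ifs
          · exact SetLike.one_mem_graded B.grading
          · exact Submodule.zero_mem _
        mul_mem := by
          intro i j x y hx hy
          rw [mem] at hx hy ⊢
          intro n
          rw [mul]
          exact Submodule.sum_mem _ fun p _ => SetLike.mul_mem_graded (hx p.1) (hy p.2)
        toDecomposition := IsInternal.chooseDecomposition G
          ((isInternal_submodule_iff_isCompl G (i := 0) (j := 1) (by decide)
            (by ext i; simpa using zmod_cases i)).mpr compl) }
    super_comm := by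
      intro i j x y hx hy
      rw [mem] at hx hy
      refine inj _ _ fun n => ?_
      have hs : ∀ (e : ℕ) (z : C), coef n ((-1) ^ e * z) = (-1) ^ e * coef n z := by
        intro e z
        rcases Nat.even_or_odd e with h | h <;> simp [h.neg_one_pow]
      rw [hs, mul, mul, ← Finset.Nat.sum_antidiagonal_swap, Finset.mul_sum]
      exact Finset.sum_congr rfl fun p _ => B.super_comm i j _ _ (hx p.1) (hy p.2) }

variable (B : SuperCommAlg k)

/-- The superalgebra `B[z]`. -/
noncomputable def poly : SuperCommAlg k :=
  ofCoeff B (Polynomial B)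
    (fun n => { toFun := fun p => p.coeff n, map_add' := fun _ _ => Polynomial.coeff_add _ _ _,
                map_smul' := fun _ _ => Polynomial.coeff_smul _ _ _ })
    (fun _ _ h => Polynomial.ext h)
    (fun n => by simp [Polynomial.coeff_one])
    (fun n x y => Polynomial.coeff_mul x y n)
    (fun x => by
      induction x using Polynomial.induction_on' with
      | add p q hp hq =>
        obtain ⟨p', hp⟩ := hp
        obtain ⟨q', hq⟩ := hq
        refine ⟨p' + q', fun n => ?_⟩
        rw [map_add, map_add, hp, hq, decompose_add]
        rfl
      | monomial l a =>
        refine ⟨Polynomial.monomial l (decompose B.grading a 0 : B), fun n => ?_⟩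
        change (Polynomial.monomial l _).coeff n =
          (decompose B.grading ((Polynomial.monomial l a).coeff n) 0 : B)
        rw [Polynomial.coeff_monomial, Polynomial.coeff_monomial]
        split_ifs
        · rfl
        · simp)

/-- The superalgebra `B[[z]]`. -/
noncomputable def series : SuperCommAlg k :=
  ofCoeff B (PowerSeries B)
    (fun n => { toFun := fun p => PowerSeries.coeff n p, map_add' := fun _ _ => map_add _ _ _,
                map_smul' := fun _ _ => rfl })
    (fun _ _ h => PowerSeries.ext h)
    PowerSeries.coeff_one
    (fun n x y => PowerSeries.coeff_mul n x y)
    (fun x => ⟨PowerSeries.mk fun n => decompose B.grading (PowerSeries.coeff n x) 0,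
      fun _ => PowerSeries.coeff_mk _ _⟩)

variable {B}

theorem mem_poly {i : ZMod 2} {x : Polynomial B} :
    x ∈ B.poly.grading i ↔ ∀ n, x.coeff n ∈ B.grading i :=
  Submodule.mem_iInf _

theorem mem_series {i : ZMod 2} {x : PowerSeries B} :
    x ∈ B.series.grading i ↔ ∀ n, PowerSeries.coeff n x ∈ B.grading i :=
  Submodule.mem_iInf _

variable (B)

/-- The inclusion `B[z] → B[[z]]`. -/
noncomputable def polyToSeries : Hom B.poly B.series where
  toAlgHom :=
    { (Polynomial.coeToPowerSeries.ringHom : Polynomial B →+* PowerSeries B) with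
      commutes' := fun c => by
        change ((algebraMap k (Polynomial B) c : Polynomial B) : PowerSeries B) =
          algebraMap k (PowerSeries B) c
        rw [Polynomial.algebraMap_apply, Polynomial.coe_C, PowerSeries.algebraMap_apply] }
  map_mem i (x : Polynomial B) hx := by
    refine mem_series.mpr fun n => ?_
    change PowerSeries.coeff n (x : PowerSeries B) ∈ _
    rw [Polynomial.coeff_coe]
    exact mem_poly.mp hx n

theorem polyToSeries_injective : Function.Injective B.polyToSeries :=
  fun _ _ h => Polynomial.coe_injective B h

/-- The evaluation `B[z] → B` at `z = 1`. -/
noncomputable def polyEvalOne : Hom B.poly B where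
  toAlgHom :=
    { (Polynomial.eval₂RingHom' (RingHom.id B) 1 fun _ => Commute.one_right _ :
        Polynomial B →+* B) with
      commutes' := fun c => by
        change Polynomial.eval₂ (RingHom.id B) 1 (algebraMap k (Polynomial B) c) = _
        rw [Polynomial.algebraMap_apply, Polynomial.eval₂_C]
        rfl }
  map_mem i (x : Polynomial B) hx := by
    change Polynomial.eval₂ (RingHom.id B) 1 x ∈ _
    rw [Polynomial.eval₂_eq_sum_range]
    refine Submodule.sum_mem _ fun n _ => ?_
    rw [one_pow, mul_one]
    exact mem_poly.mp hx n

end coefficients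

/-! ### The two systems of equations for the Berezinian at invertible matrices, and their
naturality. -/

section defects

variable {B : SuperCommAlg k} {r s : ℕ}

/-- The left-hand side of the fundamental equation for the Berezinian. -/
noncomputable def fundamentalDefect (α : ℕ) (i : Fin r ⊕ Fin s) (x : Fin r ⊕ Fin s → B)
    (β : ℕ) (j : Fin r ⊕ Fin s) (y : Fin r ⊕ Fin s → B)
    (W : Matrix (Fin r ⊕ Fin s) (Fin r ⊕ Fin s) B) : B :=
  berDeriv₂ α i x β j y W +
    (-1) ^ (par i * par j + α * (par i + par j)) * berDeriv₂ α j x β i y W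

/-- The left-hand side of the Khudaverdian relation for the Berezinian. -/
noncomputable def khudaverdianDefect (α : ℕ) (i : Fin r ⊕ Fin s) (x : Fin r ⊕ Fin s → B)
    (β : ℕ) (j : Fin r ⊕ Fin s) (y : Fin r ⊕ Fin s → B)
    (W : Matrix (Fin r ⊕ Fin s) (Fin r ⊕ Fin s) B) : B :=
  berDeriv α i x W * berDeriv β j y W -
    (-1) ^ (par i * par j + α * (par i + par j)) * (berDeriv α j x W * berDeriv β i y W) -
    B.ber W * berDeriv₂ α i x β j y W

variable {W W' : Matrix (Fin r ⊕ Fin s) (Fin r ⊕ Fin s) B}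

/-- Exchanging `i` and `j` multiplies the bracket in `berDeriv₂_eq` by `-σ`, where the sign `σ` is
symmetric in `i` and `j` and `σ² = 1`. -/
theorem fundamentalDefect_eq_zero_of_inverse (h2 : (2 : k) ≠ 0) (hW : B.IsEvenMatrix W)
    (h : W * W' = 1) (h' : W' * W = 1) (α β : ℕ) (i j : Fin r ⊕ Fin s) {x y : Fin r ⊕ Fin s → B}
    (hx : ∀ l, x l ∈ B.grading ((par l + α : ℕ) : ZMod 2))
    (hy : ∀ l, y l ∈ B.grading ((par l + β : ℕ) : ZMod 2)) :
    fundamentalDefect α i x β j y W = 0 := by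
  rw [fundamentalDefect, berDeriv₂_eq h2 hW h h' α β i j hx hy,
    berDeriv₂_eq h2 hW h h' α β j i hx hy, Nat.mul_comm (par j), Nat.add_comm (par j)]
  rcases neg_one_pow_eq_or B (α + β) with h | h <;>
  rcases neg_one_pow_eq_or B (par i * par j + α * (par i + par j)) with h' | h' <;>
  rw [h, h'] <;> noncomm_ring

/-- The Berezinian is even, so it can be moved out of the products of first derivatives. They then
combine to `Ber²` times the bracket of `berDeriv₂_eq`, with the same overall sign `(-1)^{α+β}`. -/
theorem khudaverdianDefect_eq_zero_of_inverse (h2 : (2 : k) ≠ 0) (hW : B.IsEvenMatrix W)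
    (h : W * W' = 1) (h' : W' * W = 1) (α β : ℕ) (i j : Fin r ⊕ Fin s) {x y : Fin r ⊕ Fin s → B}
    (hx : ∀ l, x l ∈ B.grading ((par l + α : ℕ) : ZMod 2))
    (hy : ∀ l, y l ∈ B.grading ((par l + β : ℕ) : ZMod 2)) :
    khudaverdianDefect α i x β j y W = 0 := by
  have hF : ∀ a b : B, (B.ber W : B) * a * (B.ber W * b) = B.ber W * (B.ber W * (a * b)) := by
    intro a b
    rw [mul_assoc, ← mul_assoc a, ← B.even_mul_comm (B.ber W).2 a, mul_assoc (B.ber W : B) a b]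
  have key : ∀ a b : B, (-1) ^ α * ((B.ber W : B) * a) * ((-1) ^ β * (B.ber W * b)) =
      (-1) ^ (α + β) * (B.ber W * (B.ber W * (a * b))) := by
    intro a b
    rw [← hF, pow_add _ α β]
    rcases neg_one_pow_eq_or B α with h | h <;> rcases neg_one_pow_eq_or B β with h' | h' <;>
    rw [h, h'] <;> noncomm_ring
  rw [khudaverdianDefect, berDeriv₂_eq h2 hW h h' α β i j hx hy, berDeriv_eq h2 hW h h' α i hx,
    berDeriv_eq h2 hW h h' β j hy, berDeriv_eq h2 hW h h' α j hx, berDeriv_eq h2 hW h h' β i hy,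
    key, key]
  rcases neg_one_pow_eq_or B (α + β) with h | h <;>
  rcases neg_one_pow_eq_or B (par i * par j + α * (par i + par j)) with h' | h' <;>
  rw [h, h'] <;> noncomm_ring

/-- Naturality needs only an invertible odd-odd block. It is what lets the equations travel between
`B`, `B[z]` and `B[[z]]`. -/
theorem Hom.map_berDeriv {C : SuperCommAlg k} (f : Hom B C)
    (hu : IsUnit (B.oddBlock W).det) (α : ℕ) (i : Fin r ⊕ Fin s) (x : Fin r ⊕ Fin s → B) :
    f (berDeriv α i x W) = berDeriv α i (fun l => f (x l)) (W.map f) := by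
  rw [berDeriv, berDeriv, ← colShift_map_eps,
    (f.eps _).map_ber _ (isUnit_det_oddBlock_colShift hu _ i x)]
  rfl

theorem Hom.map_berDeriv₂ {C : SuperCommAlg k} (f : Hom B C)
    (hu : IsUnit (B.oddBlock W).det) (α β : ℕ) (i j : Fin r ⊕ Fin s) (x y : Fin r ⊕ Fin s → B) :
    f (berDeriv₂ α i x β j y W) =
      berDeriv₂ α i (fun l => f (x l)) β j (fun l => f (y l)) (W.map f) := by
  have e : (fun l => f.eps ((α + par i : ℕ) : ZMod 2) (B.epsIncl _ (y l))) =
      fun l => C.epsIncl _ (f (y l)) :=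
    funext fun l => eps_ext rfl (map_zero f.toAlgHom)
  rw [berDeriv₂, berDeriv₂, ← colShift_map_eps, ← e,
    ← (f.eps _).map_berDeriv (isUnit_det_oddBlock_colShift hu _ i x)]
  rfl

theorem Hom.map_fundamentalDefect {C : SuperCommAlg k} (f : Hom B C)
    (hu : IsUnit (B.oddBlock W).det) (α β : ℕ) (i j : Fin r ⊕ Fin s) (x y : Fin r ⊕ Fin s → B) :
    f (fundamentalDefect α i x β j y W) =
      fundamentalDefect α i (fun l => f (x l)) β j (fun l => f (y l)) (W.map f) := by
  simp only [fundamentalDefect, map_add, map_mul, map_pow, map_neg, map_one, f.map_berDeriv₂ hu]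

theorem Hom.map_khudaverdianDefect {C : SuperCommAlg k} (f : Hom B C)
    (hu : IsUnit (B.oddBlock W).det) (α β : ℕ) (i j : Fin r ⊕ Fin s) (x y : Fin r ⊕ Fin s → B) :
    f (khudaverdianDefect α i x β j y W) =
      khudaverdianDefect α i (fun l => f (x l)) β j (fun l => f (y l)) (W.map f) := by
  have e : (C.ber (W.map f) : C) = f (B.ber W) := congrArg Subtype.val (f.map_ber W hu)
  simp only [khudaverdianDefect, map_sub, map_mul, map_pow, map_neg, map_one, f.map_berDeriv₂ hu,
    f.map_berDeriv hu, e]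

end defects

/-! ### Deformation to an invertible matrix. -/

/-- A matrix pencil `Z + z (W - Z)` with `Z` invertible is invertible over the power series. -/
theorem exists_series_inverse {R ι : Type*} [Ring R] [Fintype ι] [DecidableEq ι]
    (W : Matrix ι ι R) {Z Z' : Matrix ι ι R} (h : Z * Z' = 1) (h' : Z' * Z = 1) :
    ∃ H : Matrix ι ι (PowerSeries R),
      (Matrix.of fun i j => PowerSeries.C (Z i j) + PowerSeries.X * PowerSeries.C (W i j - Z i j)) *
        H = 1 ∧
      H * (Matrix.of fun i j =>
        PowerSeries.C (Z i j) + PowerSeries.X * PowerSeries.C (W i j - Z i j)) = 1 := by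
  -- The pencil is `Z (1 + zN)` with `z` central, so its inverse is the geometric series `∑ (-N)ⁿ
  -- zⁿ` times `Z⁻¹`.
  set N := Z' * (W - Z) with hN
  have hZN : W - Z = Z * N := by rw [hN, ← Matrix.mul_assoc, h, Matrix.one_mul]
  have hone : ∀ (n : ℕ) (i j : ι), PowerSeries.coeff n ((1 : Matrix ι ι (PowerSeries R)) i j) =
      if n = 0 then (1 : Matrix ι ι R) i j else 0 := by
    intro n i j
    rw [Matrix.one_apply, Matrix.one_apply, apply_ite (PowerSeries.coeff n), PowerSeries.coeff_one,
      map_zero]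
    split_ifs <;> rfl
  refine ⟨Matrix.of fun i j => PowerSeries.mk fun n => ((-N) ^ n * Z') i j, ?_, ?_⟩
  · ext i j n
    rw [hone, Matrix.mul_apply, map_sum]
    simp only [Matrix.of_apply, add_mul, map_add, mul_assoc, PowerSeries.coeff_C_mul,
      PowerSeries.coeff_mk, Finset.sum_add_distrib]
    rw [← Matrix.mul_apply]
    rcases n with _ | n
    · simp only [PowerSeries.coeff_zero_X_mul, pow_zero, Matrix.one_mul, h, if_true]
      simp
    · simp only [PowerSeries.coeff_succ_X_mul, PowerSeries.coeff_C_mul, PowerSeries.coeff_mk,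
        ← Matrix.sub_apply W Z]
      rw [← Matrix.mul_apply, ← Matrix.add_apply, hZN, pow_succ', ← Matrix.mul_assoc Z,
        ← Matrix.mul_assoc Z, ← Matrix.mul_assoc (Z * N), Matrix.mul_neg, Matrix.neg_mul,
        Matrix.neg_mul, Matrix.mul_assoc, Matrix.mul_assoc, neg_add_cancel, if_neg n.succ_ne_zero,
        Matrix.zero_apply]
  · ext i j n
    rw [hone, Matrix.mul_apply, map_sum]
    simp only [Matrix.of_apply, mul_add, map_add, ← mul_assoc, ← PowerSeries.X_mul,
      PowerSeries.coeff_mul_C, PowerSeries.coeff_mk, Finset.sum_add_distrib]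
    rw [← Matrix.mul_apply]
    rcases n with _ | n
    · simp only [PowerSeries.coeff_zero_X_mul, pow_zero, Matrix.one_mul, h', if_true]
      simp
    · simp only [PowerSeries.coeff_succ_X_mul, PowerSeries.coeff_mk, ← Matrix.sub_apply W Z]
      rw [← Matrix.mul_apply, ← Matrix.add_apply, Matrix.mul_assoc, h', Matrix.mul_one,
        Matrix.mul_assoc, ← hN, pow_succ, Matrix.mul_neg, neg_add_cancel, if_neg n.succ_ne_zero,
        Matrix.zero_apply]

variable (B : SuperCommAlg k)

/-- The inclusion of the constants `B → B[z]`. -/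
noncomputable def polyConst : Hom B B.poly where
  toAlgHom :=
    { (Polynomial.C : B →+* Polynomial B) with
      commutes' := fun _ => rfl }
  map_mem i x hx := by
    refine mem_poly.mpr fun n => ?_
    change (Polynomial.C x).coeff n ∈ _
    rw [Polynomial.coeff_C]
    split_ifs
    · exact hx
    · exact Submodule.zero_mem _

/-- The variable of `B[z]`. -/
noncomputable def polyVar : B.poly := (Polynomial.X : Polynomial B)

theorem polyVar_mem : B.polyVar ∈ B.poly.grading 0 := by
  refine mem_poly.mpr fun n => ?_
  change (Polynomial.X : Polynomial B).coeff n ∈ _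
  rw [Polynomial.coeff_X]
  split_ifs
  · exact SetLike.one_mem_graded B.grading
  · exact Submodule.zero_mem _

theorem polyEvalOne_polyVar : B.polyEvalOne B.polyVar = 1 :=
  Polynomial.eval₂_X (RingHom.id B) 1

theorem polyEvalOne_polyConst (x : B) : B.polyEvalOne (B.polyConst x) = x :=
  Polynomial.eval₂_C (RingHom.id B) 1

variable {B} {r s : ℕ}

/-- Every even supermatrix with invertible odd-odd block is the value at `z = 1` of a supermatrix
over `B[z]` which is invertible over `B[[z]]`. -/
theorem IsEvenMatrix.exists_deformation {W : Matrix (Fin r ⊕ Fin s) (Fin r ⊕ Fin s) B}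
    (hW : B.IsEvenMatrix W) (hu : IsUnit (B.oddBlock W).det) :
    ∃ V : Matrix (Fin r ⊕ Fin s) (Fin r ⊕ Fin s) B.poly, B.poly.IsEvenMatrix V ∧
      IsUnit (B.poly.oddBlock V).det ∧ V.map B.polyEvalOne = W ∧
      ∃ V', V.map B.polyToSeries * V' = 1 ∧ V' * V.map B.polyToSeries = 1 := by
  obtain ⟨A, b, c, D, hb, hc, rfl⟩ := hW.exists_superBlocks
  rw [oddBlock_superBlocks] at hu
  set W := superBlocks A b c D with hWdef
  -- `Z` is invertible and shares the odd-odd block `D` with `W`. Hence the pencil has constant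
  -- odd-odd block and its Berezinian is defined over `B[z]` itself.
  set Z : Matrix (Fin r ⊕ Fin s) (Fin r ⊕ Fin s) B := superBlocks 1 0 0 D with hZ
  have h0 : ∀ {m n : Type}, B.EntriesIn 1 (0 : Matrix m n B) := fun _ _ => Submodule.zero_mem _
  have hZe : B.IsEvenMatrix Z := isEvenMatrix_superBlocks h0 h0
  have hZZ : Z * superBlocks 1 0 0 D⁻¹ = 1 := by
    rw [hZ, superBlocks_mul_diag, Matrix.zero_mul, Matrix.zero_mul, Matrix.one_mul,
      Matrix.mul_nonsing_inv _ hu, superBlocks, map_evenVal_one, map_evenVal_one,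
      Matrix.fromBlocks_one]
  have hZZ' : superBlocks 1 0 0 D⁻¹ * Z = 1 := by
    rw [hZ, superBlocks_mul_diag, Matrix.zero_mul, Matrix.zero_mul, Matrix.one_mul,
      Matrix.nonsing_inv_mul _ hu, superBlocks, map_evenVal_one, map_evenVal_one,
      Matrix.fromBlocks_one]
  let V : Matrix (Fin r ⊕ Fin s) (Fin r ⊕ Fin s) B.poly := fun i j =>
    B.polyConst (Z i j) + B.polyVar * B.polyConst (W i j - Z i j)
  refine ⟨V, ?_, ?_, ?_, ?_⟩
  · intro i j
    refine Submodule.add_mem _ (B.polyConst.map_mem _ _ (hZe i j)) ?_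
    have := SetLike.mul_mem_graded (A := B.poly.grading) B.polyVar_mem
      (B.polyConst.map_mem _ _ (Submodule.sub_mem _ (hW i j) (hZe i j)))
    rwa [zero_add] at this
  · have e : B.poly.oddBlock V = B.poly.oddBlock (Z.map B.polyConst) := by
      ext i j : 1
      change B.poly.ev (B.polyConst (Z (.inr i) (.inr j)) + B.polyVar *
        B.polyConst (W (.inr i) (.inr j) - Z (.inr i) (.inr j))) =
          B.poly.ev (B.polyConst (Z (.inr i) (.inr j)))
      have : W (.inr i) (.inr j) = Z (.inr i) (.inr j) := rfl
      rw [this, sub_self, map_zero, mul_zero, add_zero]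
    rw [e, B.polyConst.map_det_oddBlock, hZ, oddBlock_superBlocks]
    exact hu.map _
  · ext i j
    change B.polyEvalOne (B.polyConst (Z i j) + B.polyVar * B.polyConst (W i j - Z i j)) = W i j
    rw [map_add, map_mul, polyEvalOne_polyVar, polyEvalOne_polyConst, polyEvalOne_polyConst,
      one_mul, add_sub_cancel]
  · obtain ⟨H, hH, hH'⟩ := exists_series_inverse W hZZ hZZ'
    have e : V.map B.polyToSeries = Matrix.of fun i j =>
        PowerSeries.C (Z i j) + PowerSeries.X * PowerSeries.C (W i j - Z i j) := by
      ext i j : 2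
      change ((Polynomial.C (Z i j) + Polynomial.X * Polynomial.C (W i j - Z i j) :
        Polynomial B) : PowerSeries B) = _
      simp only [Polynomial.coe_add, Polynomial.coe_mul, Polynomial.coe_C, Polynomial.coe_X,
        Matrix.of_apply]
      rfl
    rw [e]
    exact ⟨H, hH, hH'⟩

variable {W : Matrix (Fin r ⊕ Fin s) (Fin r ⊕ Fin s) B}

/-- The defect of the pencil lies in `B[z]`. It vanishes in `B[[z]]`, where the pencil is
invertible, hence in `B[z]`, where `z = 1` may be substituted; a power series could not be evaluated
there. -/
theorem fundamentalDefect_eq_zero (h2 : (2 : k) ≠ 0) (hW : B.IsEvenMatrix W)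
    (hu : IsUnit (B.oddBlock W).det) (α β : ℕ) (i j : Fin r ⊕ Fin s) {x y : Fin r ⊕ Fin s → B}
    (hx : ∀ l, x l ∈ B.grading ((par l + α : ℕ) : ZMod 2))
    (hy : ∀ l, y l ∈ B.grading ((par l + β : ℕ) : ZMod 2)) :
    fundamentalDefect α i x β j y W = 0 := by
  obtain ⟨V, hV, hVu, hVW, V', h, h'⟩ := hW.exists_deformation hu
  have key : fundamentalDefect α i (fun l => B.polyConst (x l)) β j
      (fun l => B.polyConst (y l)) V = 0 := by
    apply B.polyToSeries_injective
    rw [B.polyToSeries.map_fundamentalDefect hVu, map_zero]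
    exact fundamentalDefect_eq_zero_of_inverse h2
      (fun l j => B.polyToSeries.map_mem _ _ (hV l j)) h h' α β i j
      (fun l => B.polyToSeries.map_mem _ _ (B.polyConst.map_mem _ _ (hx l)))
      (fun l => B.polyToSeries.map_mem _ _ (B.polyConst.map_mem _ _ (hy l)))
  have e := congrArg B.polyEvalOne key
  rw [B.polyEvalOne.map_fundamentalDefect hVu, hVW, map_zero] at e
  simpa only [polyEvalOne_polyConst] using e

theorem khudaverdianDefect_eq_zero (h2 : (2 : k) ≠ 0) (hW : B.IsEvenMatrix W)
    (hu : IsUnit (B.oddBlock W).det) (α β : ℕ) (i j : Fin r ⊕ Fin s) {x y : Fin r ⊕ Fin s → B}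
    (hx : ∀ l, x l ∈ B.grading ((par l + α : ℕ) : ZMod 2))
    (hy : ∀ l, y l ∈ B.grading ((par l + β : ℕ) : ZMod 2)) :
    khudaverdianDefect α i x β j y W = 0 := by
  obtain ⟨V, hV, hVu, hVW, V', h, h'⟩ := hW.exists_deformation hu
  have key : khudaverdianDefect α i (fun l => B.polyConst (x l)) β j
      (fun l => B.polyConst (y l)) V = 0 := by
    apply B.polyToSeries_injective
    rw [B.polyToSeries.map_khudaverdianDefect hVu, map_zero]
    exact khudaverdianDefect_eq_zero_of_inverse h2
      (fun l j => B.polyToSeries.map_mem _ _ (hV l j)) h h' α β i j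
      (fun l => B.polyToSeries.map_mem _ _ (B.polyConst.map_mem _ _ (hx l)))
      (fun l => B.polyToSeries.map_mem _ _ (B.polyConst.map_mem _ _ (hy l)))
  have e := congrArg B.polyEvalOne key
  rw [B.polyEvalOne.map_khudaverdianDefect hVu, hVW, map_zero] at e
  simpa only [polyEvalOne_polyConst] using e

end SuperCommAlg

/-! ### From derivatives in the coordinates `p_a^i` to column derivatives of the Berezinian. -/

namespace SuperFunction

variable {k : Type u} [Field k] {A : SuperCommAlg k} {n m r s : ℕ}

/-- The shifted entry is `1`, which is even, so `ε` may stand on either side of it. -/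
theorem shift_eq_colShift {B : SuperCommAlg k} (P : Matrix (Fin n ⊕ Fin m) (Fin r ⊕ Fin s) B)
    (a : Fin n ⊕ Fin m) (i : Fin r ⊕ Fin s) :
    shift P a i = colShift ((par a + par i : ℕ) : ZMod 2) P i (Pi.single a 1) := by
  ext b j
  refine eps_ext rfl ?_
  change (if b = a ∧ j = i then (1 : B) else 0) =
    if j = i then B.twist _ (Pi.single (M := fun _ => B) a 1 b) else 0
  by_cases hj : j = i
  · by_cases hb : b = a
    · subst hb
      simp [hj, Eps.twist_one']
    · simp [hj, hb, Eps.twist_zero']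
  · simp [hj]

/-- The pairing with the shifted covectors is the shifted pairing. -/
theorem map_mul_shift {ι : Type*} (U : Matrix ι (Fin n ⊕ Fin m) A) {B : SuperCommAlg k}
    (φ : Hom A B) (P : Matrix (Fin n ⊕ Fin m) (Fin r ⊕ Fin s) B) (a : Fin n ⊕ Fin m)
    (i : Fin r ⊕ Fin s) :
    U.map ((B.epsIncl ((par a + par i : ℕ) : ZMod 2)).comp φ) * shift P a i =
      colShift ((par a + par i : ℕ) : ZMod 2) (U.map φ * P) i (fun l => φ (U l a)) := by
  have h := map_mul_colShift ((par a + par i : ℕ) : ZMod 2) (U.map φ) P i (Pi.single a 1)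
  rw [Matrix.mulVec_single_one] at h
  rw [shift_eq_colShift]
  exact h

theorem Dom.shift {F : SuperFunction A n m r s} {B : SuperCommAlg k} {φ : Hom A B}
    {P : Matrix (Fin n ⊕ Fin m) (Fin r ⊕ Fin s) B} (h : F.Dom φ P) (a : Fin n ⊕ Fin m)
    (i : Fin r ⊕ Fin s) : F.Dom ((B.epsIncl _).comp φ) (shift P a i) :=
  ⟨shift_even h.1 a i, F.isUnit_den_shift φ h.1 h.2 a i⟩

section wedge

variable {F : SuperFunction A n m r s} {U : Matrix (Fin r ⊕ Fin s) (Fin n ⊕ Fin m) A}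
  {B : SuperCommAlg k} {φ : Hom A B} {P : Matrix (Fin n ⊕ Fin m) (Fin r ⊕ Fin s) B}

/-- A derivative over `B` is a value of `F` over `B[ε]`, which is why the agreement with the wedge
product is needed over all superalgebras at once. -/
theorem pderiv_val_eq_berDeriv (hF : ∀ {B : SuperCommAlg k} (φ : Hom A B)
      (P : Matrix (Fin n ⊕ Fin m) (Fin r ⊕ Fin s) B),
      F.Dom φ P → F.val φ P = (nonlinearWedge U).val φ P) (hP : F.Dom φ P)
    (a : Fin n ⊕ Fin m) (i : Fin r ⊕ Fin s) :
    (pderiv a i F).val φ P = berDeriv (par a) i (fun l => φ (U l a)) (U.map φ * P) := by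
  rw [berDeriv, ← map_mul_shift U φ P a i]
  change B.epsSnd ((par a + par i : ℕ) : ZMod 2)
    (F.val ((B.epsIncl ((par a + par i : ℕ) : ZMod 2)).comp φ) (shift P a i)) = _
  rw [hF _ _ (hP.shift a i)]
  rfl

theorem pderiv_pderiv_val_eq_berDeriv₂ (hF : ∀ {B : SuperCommAlg k} (φ : Hom A B)
      (P : Matrix (Fin n ⊕ Fin m) (Fin r ⊕ Fin s) B),
      F.Dom φ P → F.val φ P = (nonlinearWedge U).val φ P) (hP : F.Dom φ P)
    (a b : Fin n ⊕ Fin m) (i j : Fin r ⊕ Fin s) :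
    (pderiv a i (pderiv b j F)).val φ P =
      berDeriv₂ (par a) i (fun l => φ (U l a)) (par b) j (fun l => φ (U l b)) (U.map φ * P) := by
  rw [berDeriv₂, ← map_mul_shift U φ P a i]
  change B.epsSnd ((par a + par i : ℕ) : ZMod 2) ((pderiv b j F).val
    ((B.epsIncl ((par a + par i : ℕ) : ZMod 2)).comp φ) (shift P a i)) = _
  rw [pderiv_val_eq_berDeriv hF (hP.shift a i)]
  rfl

end wedge

end SuperFunction

theorem mainTheorem11 {k : Type u} [Field k] (h2 : (2 : k) ≠ 0) (A : SuperCommAlg k)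
    (n m r s : ℕ) (F : SuperFunction A n m r s) (hF : F.IsSimple) :
    F.IsMultivector ∧ F.SatisfiesKhudaverdianRelations := by
  obtain ⟨U, hU, -, hF⟩ := hF
  have hval : ∀ {B : SuperCommAlg k} (φ : Hom A B)
      (P : Matrix (Fin n ⊕ Fin m) (Fin r ⊕ Fin s) B),
      F.Dom φ P → F.val φ P = (SuperFunction.nonlinearWedge U).val φ P := fun φ P => (hF φ P).2
  have hUe : ∀ {B : SuperCommAlg k} (φ : Hom A B), B.IsEvenMatrix (U.map φ) :=
    fun φ i j => φ.map_mem _ _ (hU i j)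
  have hW : ∀ {B : SuperCommAlg k} {φ : Hom A B}
      {P : Matrix (Fin n ⊕ Fin m) (Fin r ⊕ Fin s) B}, F.Dom φ P →
      B.IsEvenMatrix (U.map φ * P) ∧ IsUnit (B.oddBlock (U.map φ * P)).det :=
    fun {B φ P} hP => ⟨(hUe φ).mul hP.1, ((hF φ P).1.mp hP).2⟩
  have hsign : ∀ (B : SuperCommAlg k) (a : Fin n ⊕ Fin m) (i j : Fin r ⊕ Fin s),
      (SuperFunction.sign a i j : B) = (-1) ^ (par i * par j + par a * (par i + par j)) := by
    intro B a i j
    rw [SuperFunction.sign, Int.cast_pow, Int.cast_neg, Int.cast_one]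
  refine ⟨⟨?_, ?_⟩, ?_⟩
  · intro B φ P g hP hg hgu
    -- Covariance is multiplicativity of the Berezinian for `U (P g) = (U P) g`, where `U P` itself
    -- may fail to be invertible.
    obtain ⟨h1, h2, h3⟩ := rightBer h2 hg (hg.isUnit_det_oddBlock h2 hgu) _ (hW hP).1 (hW hP).2
    rw [Matrix.mul_assoc] at h2 h3
    have hD : F.Dom φ (P * g) := (hF φ (P * g)).1.mpr ⟨hP.1.mul hg, h2⟩
    refine ⟨hD, ?_⟩
    rw [hval φ _ hD, hval φ P hP]
    exact congrArg Subtype.val h3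
  · intro a b i j B φ P hP
    rw [SuperFunction.pderiv_pderiv_val_eq_berDeriv₂ hval hP,
      SuperFunction.pderiv_pderiv_val_eq_berDeriv₂ hval hP, hsign]
    exact fundamentalDefect_eq_zero h2 (hW hP).1 (hW hP).2 _ _ i j
      (fun l => hUe φ l a) (fun l => hUe φ l b)
  · intro a b i j B φ P hP
    rw [SuperFunction.pderiv_pderiv_val_eq_berDeriv₂ hval hP,
      SuperFunction.pderiv_val_eq_berDeriv hval hP,
      SuperFunction.pderiv_val_eq_berDeriv hval hP, SuperFunction.pderiv_val_eq_berDeriv hval hP,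
      SuperFunction.pderiv_val_eq_berDeriv hval hP, hsign, hval φ P hP]
    exact khudaverdianDefect_eq_zero h2 (hW hP).1 (hW hP).2 _ _ i j
      (fun l => hUe φ l a) (fun l => hUe φ l b)
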